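/- Let $\Sigma$ be a finite alphabet and $X\subset\Sigma^{\mathbb Z}$ a subshift (a closed shift-invariant set) with language $\mathcal L(X)$ of admissible words. For $v\in\mathcal L(X)$ and $l\ge 0$ put $\Gamma^+(v)=\{c\in\mathcal L(X): vc\in\mathcal L(X)\}$, $\Gamma^-_l(v)=\{b\in\mathcal L(X): |b|=l,\ bv\in\mathcal L(X)\}$, and let $\mathcal S_l(X)$ be the set of $l$-synchronizing words, i.e. of those $v\in\mathcal L(X)$ such that $bvc\in\mathcal L(X)$ for all $b\in\Gamma^-_l(v)$ and $c\in\Gamma^+(v)$. The subshift $X$ is $\lambda$-synchronizing if for every $w\in\mathcal L(X)$ and every $k\ge 0$ the set $\mathcal S_k(X)\cap\Gamma^+(w)$ is non-empty. A $\lambda$-graph system over $\Sigma$ consists of finite vertex sets $V_l$, finite sets $E_{l,l+1}$ of edges from $V_l$ to $V_{l+1}$ with labels in $\Sigma$, and surjections $\iota_{l,l+1}:V_{l+1}\to V_l$ ($l\ge 0$), such that for all $u\in V_l$, $v\in V_{l+2}$ there is a label-preserving bijection between the edges $e\in E_{l+1,l+2}$ that end at $v$ with $\iota(s(e))=u$ and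 the edges in $E_{l,l+1}$ from $u$ to $\iota(v)$. Its symbolic matrix system is the sequence $(\mathcal M_{l,l+1},I_{l,l+1})_{l\ge0}$ of $V_l\times V_{l+1}$ matrices, where $\mathcal M_{l,l+1}(u,v)$ is the formal sum of the labels of the edges from $u$ to $v$, and $I_{l,l+1}(u,v)$ is $1$ if $\iota(v)=u$ and $0$ otherwise. In general a symbolic matrix system $(\mathcal M,I)$ over a finite alphabet consists of finite symbolic matrices $\mathcal M_{l,l+1}$ (entries: finite formal sums of symbols) and $\{0,1\}$-matrices $I_{l,l+1}$, both of size $m(l)\times m(l+1)$, $l\ge0$, such that $I_{l,l+1}\mathcal M_{l+1,l+2}=\mathcal M_{l,l+1}I_{l+1,l+2}$, every row of $I_{l,l+1}$ contains a $1$, and every column of $I_{l,l+1}$ contains exactly one $1$. For a $\lambda$-synchronizing subshift $X$, the $\lambda$-synchronizing $\lambda$-graph system $\mathfrak L^{\lambda(X)}$ has as $V_l$ the set of classes $[\mu]_l$ of words $\mu\in\mathcal S_l(X)$ under the equivalence $\Gamma^-_l(\mu)=\Gamma^-_l(\nu)$; it has exactly one edge labeled $\alpha$ from $[\alpha\nu]_l$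 to $[\nu]_{l+1}$ whenever $\nu\in\mathcal S_{l+1}(X)$ and $\alpha\in\Gamma^-_1(\nu)$, and no other edges; and $\iota([\mu]_{l+1})=[\mu]_l$. Let $(\mathcal M^{\lambda(X)},I^{\lambda(X)})$ be its symbolic matrix system. Two symbolic matrix systems $(\mathcal M,I)$ over $\Sigma$ and $(\mathcal M',I')$ over $\Sigma'$, of sizes $m(l)\times m(l+1)$ and $m'(l)\times m'(l+1)$, are strong shift equivalent in one step if there are finite alphabets $C,D$, injections $\varphi:\Sigma\to C\cdot D$ and $\varphi':\Sigma'\to D\cdot C$, and, for every $l\ge0$, an $m(l)\times m'(l+1)$ symbolic matrix $H_l$ over $C$ and an $m'(l)\times m(l+1)$ symbolic matrix $K_l$ over $D$ such that for all $l\ge 0$ $$I_{l,l+1}\mathcal M_{l+1,l+2}\overset{\varphi}{\simeq}H_lK_{l+1},\quad I'_{l,l+1}\mathcal M'_{l+1,l+2}\overset{\varphi'}{\simeq}K_lH_{l+1},\quad H_lI'_{l+1,l+2}=I_{l,l+1}H_{l+1},\quad K_lI_{l+1,l+2}=I'_{l,l+1}K_{l+1}.$$ Here $C\cdot D=\{cd: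 c\in C,\ d\in D\}$, and $\overset{\varphi}{\simeq}$ means that replacing every symbol $\alpha$ by $\varphi(\alpha)$ turns the left side into the right side. They are strong shift equivalent if they are joined by a finite chain of one-step strong shift equivalences of symbolic matrix systems. **Proposition 3.5.** Let $X$ and $X'$ be $\lambda$-synchronizing subshifts over finite alphabets. If $X$ is topologically conjugate to $X'$ (there is a homeomorphism $X\to X'$ that commutes with the shifts), then $(\mathcal M^{\lambda(X)},I^{\lambda(X)})$ and $(\mathcal M^{\lambda(X')},I^{\lambda(X')})$ are strong shift equivalent. -/

import Mathlib

open SymbolicDynamics.FullShift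

universe u

namespace LambdaSync

/-! ### Words of a subshift -/

section Words

variable {A : Type u} [TopologicalSpace A]

/-- The language `L(X)`: the finite words that appear somewhere in a point of `X`
(including the empty word, as soon as `X` is non-empty). -/
def language (X : Subshift A ℤ) : Set (List A) :=
  {w | ∃ x ∈ X.carrier, ∃ i : ℤ, ∀ k : Fin w.length, x (i + (k : ℕ)) = w.get k}

/-- `Γ⁺(v)`: the admissible words that can follow `v`. -/
def follower (X : Subshift A ℤ) (v : List A) : Set (List A) :=
  {c | c ∈ language X ∧ v ++ c ∈ language X}

/-- `Γ⁻_l(v)`: the admissible words of length `l` that can precede `v`. -/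
def predecessor (X : Subshift A ℤ) (l : ℕ) (v : List A) : Set (List A) :=
  {b | b ∈ language X ∧ b.length = l ∧ b ++ v ∈ language X}

/-- `ω⁻_l(v)`: the admissible words `b` of length `l` such that `b v c` is admissible for
every `c ∈ Γ⁺(v)`. -/
def omegaMinus (X : Subshift A ℤ) (l : ℕ) (v : List A) : Set (List A) :=
  {b | b ∈ language X ∧ b.length = l ∧ ∀ c ∈ follower X v, b ++ v ++ c ∈ language X}

/-- `S_l(X)`: the `l`-synchronizing words. -/
def syncWords (X : Subshift A ℤ) (l : ℕ) : Set (List A) :=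
  {v | v ∈ language X ∧ predecessor X l v ⊆ omegaMinus X l v}

/-- `X` is `λ`-synchronizing. -/
def IsLambdaSynchronizing (X : Subshift A ℤ) : Prop :=
  ∀ w ∈ language X, ∀ k : ℕ, ∃ v, v ∈ syncWords X k ∧ v ∈ follower X w

/-- Topological conjugacy: a homeomorphism that commutes with the shifts. -/
def TopologicallyConjugate {A' : Type u} [TopologicalSpace A']
    (X : Subshift A ℤ) (X' : Subshift A' ℤ) : Prop :=
  ∃ h : X.carrier ≃ₜ X'.carrier, ∀ x : X.carrier,
    (h ⟨shift 1 x.1, X.mapsTo 1 x.2⟩).1 = shift 1 (h x).1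

/-- `l`-past equivalence of `l`-synchronizing words: `Γ⁻_l(μ) = Γ⁻_l(ν)`. -/
def pastSetoid (X : Subshift A ℤ) (l : ℕ) : Setoid (syncWords X l) :=
  Setoid.ker fun v => predecessor X l v.1

/-- `V_l^{λ(X)}`: the `l`-past equivalence classes of the `l`-synchronizing words. -/
def Vertex (X : Subshift A ℤ) (l : ℕ) : Type u :=
  Quotient (pastSetoid X l)

/-- The class `[v]_l`. -/
def Vertex.mk (X : Subshift A ℤ) (l : ℕ) (v : syncWords X l) : Vertex X l :=
  Quotient.mk (pastSetoid X l) v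

/-- There is an edge labeled `α` from `[α ν]_l` to `[ν]_{l+1}` for every `(l+1)`-synchronizing
word `ν` such that `α ν` is admissible (`α ν` is then `l`-synchronizing, see
`cons_mem_syncWords`). -/
def IsEdge (X : Subshift A ℤ) (l : ℕ) (u : Vertex X l) (α : A) (v : Vertex X (l + 1)) : Prop :=
  ∃ (μ : syncWords X l) (ν : syncWords X (l + 1)),
    μ.1 = α :: ν.1 ∧ u = Vertex.mk X l μ ∧ v = Vertex.mk X (l + 1) ν

end Words

/-! ### `λ`-graph systems -/

/-- A `λ`-graph system over a finite alphabet. `E l` is the set of edges from `V l` to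
`V (l + 1)`, and `ι l : V (l + 1) → V l`. The local property contains the requirement that
a label ends at `v` if and only if it ends at `ι v`. -/
structure LambdaGraphSystem where
  Alphabet : Type u
  [finite_alphabet : Finite Alphabet]
  V : ℕ → Type u
  [finite_V : ∀ l, Finite (V l)]
  E : ℕ → Type u
  [finite_E : ∀ l, Finite (E l)]
  source : ∀ l, E l → V l
  target : ∀ l, E l → V (l + 1)
  label : ∀ l, E l → Alphabet
  ι : ∀ l, V (l + 1) → V l
  ι_surjective : ∀ l, Function.Surjective (ι l)
  /-- The label-preserving bijection between `E^ι(u, v)` and `E_ι(u, v)`. -/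
  local_property : ∀ (l : ℕ) (u : V l) (v : V (l + 2)),
    ∃ f : {e : E (l + 1) // target (l + 1) e = v ∧ ι l (source (l + 1) e) = u} ≃
        {e : E l // source l e = u ∧ target l e = ι (l + 1) v},
      ∀ e, label l (f e).1 = label (l + 1) e.1

/-! ### Symbolic matrices -/

section Matrices

variable {A C D : Type u} {m n p : Type u} [Fintype n]

/-- An entry of a symbolic matrix over `A` is a finite formal sum of symbols of `A`, that is a
multiset. This is the product of a nonnegative integer matrix and a symbolic matrix. -/
def natMulSym (N : Matrix m n ℕ) (S : Matrix n p (Multiset A)) : Matrix m p (Multiset A) :=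
  fun i j => ∑ k, N i k • S k j

/-- The product of a symbolic matrix and a nonnegative integer matrix. -/
def symMulNat (S : Matrix m n (Multiset A)) (N : Matrix n p ℕ) : Matrix m p (Multiset A) :=
  fun i j => ∑ k, N k j • S i k

/-- The product of a symbolic matrix over `C` and one over `D`, a symbolic matrix over
`C · D = {c d | c ∈ C, d ∈ D}`. -/
def symMulSym (S : Matrix m n (Multiset C)) (T : Matrix n p (Multiset D)) :
    Matrix m p (Multiset (C × D)) :=
  fun i j => ∑ k, S i k ×ˢ T k j

/-- Replace each symbol `a` by `φ a`. With `φ` injective, `relabel φ S = T` says that `S` and `T`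
are equivalent under the specification `φ`. -/
def relabel {q r : Type u} {B : Type u} (φ : A → B) (S : Matrix q r (Multiset A)) :
    Matrix q r (Multiset B) :=
  S.map (Multiset.map φ)

end Matrices

/-- A symbolic matrix system `(M, I)`; the rows and columns of the matrices `M l = M_{l,l+1}` and
`I l = I_{l,l+1}` are indexed by the finite sets `Index l` and `Index (l + 1)`. -/
structure SymbolicMatrixSystem where
  Alphabet : Type u
  [finite_alphabet : Finite Alphabet]
  Index : ℕ → Type u
  [fintype_index : ∀ l, Fintype (Index l)]
  M : ∀ l, Matrix (Index l) (Index (l + 1)) (Multiset Alphabet)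
  I : ∀ l, Matrix (Index l) (Index (l + 1)) ℕ
  I_zero_or_one : ∀ l i j, I l i j = 0 ∨ I l i j = 1
  I_row : ∀ l i, ∃ j, I l i j = 1
  I_col : ∀ l j, ∃! i, I l i j = 1
  comm : ∀ l, natMulSym (I l) (M (l + 1)) = symMulNat (M l) (I (l + 1))

attribute [instance] LambdaGraphSystem.finite_alphabet LambdaGraphSystem.finite_V
  LambdaGraphSystem.finite_E SymbolicMatrixSystem.finite_alphabet
  SymbolicMatrixSystem.fintype_index

/-- Strong shift equivalence in one step: there are finite alphabets `C`, `D`, specifications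
`φ` from `Σ` to `C · D` and `φ'` from `Σ'` to `D · C`, and symbolic matrices `H_l` over `C` and
`K_l` over `D` (of sizes `m(l) × m'(l+1)` and `m'(l) × m(l+1)`) with
`I_{l,l+1} M_{l+1,l+2} ≃ H_l K_{l+1}`, `I'_{l,l+1} M'_{l+1,l+2} ≃ K_l H_{l+1}`,
`H_l I'_{l+1,l+2} = I_{l,l+1} H_{l+1}`, `K_l I_{l+1,l+2} = I'_{l,l+1} K_{l+1}`. -/
def StrongShiftEquivalentOneStep (S S' : SymbolicMatrixSystem.{u}) : Prop :=
  ∃ (C D : Type u) (_ : Finite C) (_ : Finite D)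
    (φ : S.Alphabet → C × D) (φ' : S'.Alphabet → D × C)
    (H : ∀ l, Matrix (S.Index l) (S'.Index (l + 1)) (Multiset C))
    (K : ∀ l, Matrix (S'.Index l) (S.Index (l + 1)) (Multiset D)),
    Function.Injective φ ∧ Function.Injective φ' ∧ ∀ l,
      relabel φ (natMulSym (S.I l) (S.M (l + 1))) = symMulSym (H l) (K (l + 1)) ∧
      relabel φ' (natMulSym (S'.I l) (S'.M (l + 1))) = symMulSym (K l) (H (l + 1)) ∧
      symMulNat (H l) (S'.I (l + 1)) = natMulSym (S.I l) (H (l + 1)) ∧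
      symMulNat (K l) (S.I (l + 1)) = natMulSym (S'.I l) (K (l + 1))

/-- Strong shift equivalence: a finite chain of one-step strong shift equivalences. -/
def StrongShiftEquivalent (S S' : SymbolicMatrixSystem.{u}) : Prop :=
  Relation.TransGen StrongShiftEquivalentOneStep S S'

/-! ### The symbolic matrix system of a `λ`-graph system -/

namespace LambdaGraphSystem

open Classical in
/-- `M_{l,l+1}(u, v)`: the formal sum of the labels of the edges from `u` to `v`. -/
noncomputable def symMatrix (L : LambdaGraphSystem.{u}) (l : ℕ) :
    Matrix (L.V l) (L.V (l + 1)) (Multiset L.Alphabet) :=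
  letI := Fintype.ofFinite (L.E l)
  fun u v => ∑ e : L.E l, if L.source l e = u ∧ L.target l e = v then {L.label l e} else 0

open Classical in
/-- `I_{l,l+1}(u, v) = 1` if `ι v = u`, and `0` otherwise. -/
noncomputable def iotaMatrix (L : LambdaGraphSystem.{u}) (l : ℕ) :
    Matrix (L.V l) (L.V (l + 1)) ℕ :=
  fun u v => if L.ι l v = u then 1 else 0

theorem symMatrix_comm (L : LambdaGraphSystem.{u}) [∀ l, Fintype (L.V l)] (l : ℕ) :
    natMulSym (L.iotaMatrix l) (L.symMatrix (l + 1)) =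
      symMulNat (L.symMatrix l) (L.iotaMatrix (l + 1)) := by
  classical
  let _ := Fintype.ofFinite (L.E l)
  let _ := Fintype.ofFinite (L.E (l + 1))
  funext u v
  obtain ⟨f, hf⟩ := L.local_property l u v
  have h1 : natMulSym (L.iotaMatrix l) (L.symMatrix (l + 1)) u v =
      ∑ e : L.E (l + 1), if L.target (l + 1) e = v ∧ L.ι l (L.source (l + 1) e) = u then
        ({L.label (l + 1) e} : Multiset L.Alphabet) else 0 := by
    unfold natMulSym iotaMatrix symMatrix
    simp only [Finset.smul_sum]
    rw [Finset.sum_comm]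
    refine Finset.sum_congr (by ext; simp) fun e _ => ?_
    rw [Finset.sum_eq_single (L.source (l + 1) e)]
    · by_cases h1 : L.ι l (L.source (l + 1) e) = u <;>
        by_cases h2 : L.target (l + 1) e = v <;> simp [h1, h2]
    · intro w _ hw
      have hw' : ¬ L.source (l + 1) e = w := fun h => hw h.symm
      simp [hw']
    · simp
  have h2 : symMulNat (L.symMatrix l) (L.iotaMatrix (l + 1)) u v =
      ∑ e : L.E l, if L.source l e = u ∧ L.target l e = L.ι (l + 1) v then
        ({L.label l e} : Multiset L.Alphabet) else 0 := by
    unfold symMulNat iotaMatrix symMatrix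
    rw [Finset.sum_eq_single (L.ι (l + 1) v)]
    · simp only [if_true, one_smul]
    · intro w _ hw
      rw [if_neg (fun h => hw h.symm), zero_smul]
    · simp
  rw [h1, h2, ← Finset.sum_filter, ← Finset.sum_filter,
    ← Finset.sum_subtype_eq_sum_filter, ← Finset.sum_subtype_eq_sum_filter]
  simp only [Finset.subtype_univ]
  exact Fintype.sum_equiv f _ _ fun e => by rw [hf]

/-- The symbolic matrix system of a `λ`-graph system. -/
noncomputable def toSymbolicMatrixSystem (L : LambdaGraphSystem.{u}) :
    SymbolicMatrixSystem.{u} where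
  Alphabet := L.Alphabet
  Index := L.V
  fintype_index := fun l => Fintype.ofFinite (L.V l)
  M := L.symMatrix
  I := L.iotaMatrix
  I_zero_or_one := fun l i j => by
    unfold iotaMatrix
    split_ifs <;> simp
  I_row := fun l i => by
    obtain ⟨j, hj⟩ := L.ι_surjective l i
    exact ⟨j, by simp [iotaMatrix, hj]⟩
  I_col := fun l j => by
    refine ⟨L.ι l j, by simp [iotaMatrix], fun i hi => ?_⟩
    by_contra h
    simp [iotaMatrix, Ne.symm h] at hi
  comm := letI := fun l => Fintype.ofFinite (L.V l); L.symMatrix_comm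

end LambdaGraphSystem

/-! ### The `λ`-synchronizing `λ`-graph system -/

section LambdaSystem

variable {A : Type u} [TopologicalSpace A] {X : Subshift A ℤ}

theorem language_infix {a b c : List A} (h : a ++ b ++ c ∈ language X) : b ∈ language X := by
  obtain ⟨x, hx, i, hi⟩ := h
  refine ⟨x, hx, i + a.length, fun k => ?_⟩
  have := hi ⟨a.length + k, by simp; omega⟩
  simp only [List.get_eq_getElem] at this ⊢
  rw [List.getElem_append_left (by simp)] at this
  simp only [List.getElem_append_right (Nat.le_add_right _ _), Nat.add_sub_cancel_left] at this
  rw [← this]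
  congr 1
  push_cast
  ring

theorem language_left {a b : List A} (h : a ++ b ∈ language X) : a ∈ language X :=
  language_infix (a := []) (c := b) (by simpa using h)

theorem language_right {a b : List A} (h : a ++ b ∈ language X) : b ∈ language X :=
  language_infix (a := a) (c := []) (by simpa using h)

theorem language_cons_extend {w : List A} (h : w ∈ language X) :
    ∃ a, a :: w ∈ language X := by
  obtain ⟨x, hx, i, hi⟩ := h
  refine ⟨x (i - 1), x, hx, i - 1, fun k => ?_⟩
  obtain ⟨k, hk⟩ := k
  cases k with
  | zero => simp
  | succ k =>
    have := hi ⟨k, by simpa using hk⟩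
    simp only [List.get_eq_getElem, List.getElem_cons_succ] at this ⊢
    rw [← this]
    congr 1
    push_cast
    ring

theorem mem_predecessor {l : ℕ} {v b : List A} :
    b ∈ predecessor X l v ↔ b.length = l ∧ b ++ v ∈ language X :=
  ⟨fun h => h.2, fun h => ⟨language_left h.2, h⟩⟩

theorem mem_syncWords {l : ℕ} {v : List A} :
    v ∈ syncWords X l ↔ v ∈ language X ∧ ∀ b c : List A, b.length = l → b ++ v ∈ language X →
      v ++ c ∈ language X → b ++ v ++ c ∈ language X := by
  constructor
  · intro h
    refine ⟨h.1, fun b c hb hbv hvc => ?_⟩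
    exact (h.2 (mem_predecessor.2 ⟨hb, hbv⟩)).2.2 c ⟨language_right hvc, hvc⟩
  · intro h
    refine ⟨h.1, fun b hb => ⟨hb.1, hb.2.1, fun c hc => h.2 b c hb.2.1 hb.2.2 hc.2⟩⟩

/-- `S_{l+1}(X) ⊆ S_l(X)`. -/
theorem syncWords_succ_subset (l : ℕ) : syncWords X (l + 1) ⊆ syncWords X l := by
  intro v hv
  rw [mem_syncWords] at hv ⊢
  refine ⟨hv.1, fun b c hb hbv hvc => ?_⟩
  obtain ⟨a, ha⟩ := language_cons_extend hbv
  have := hv.2 (a :: b) c (by simp [hb]) (by simpa using ha) hvc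
  exact language_right (a := [a]) (by simpa using this)

/-- If `ν` is `(l+1)`-synchronizing and `α ν` is admissible, then `α ν` is `l`-synchronizing. -/
theorem cons_mem_syncWords {l : ℕ} {α : A} {ν : List A} (hν : ν ∈ syncWords X (l + 1))
    (h : α :: ν ∈ language X) : α :: ν ∈ syncWords X l := by
  rw [mem_syncWords] at hν ⊢
  refine ⟨h, fun b c hb hbv hvc => ?_⟩
  have := hν.2 (b ++ [α]) c (by simp [hb]) (by simpa using hbv)
    (language_right (a := [α]) (by simpa using hvc))
  simpa using this

/-- Extending an `l`-synchronizing word to the right does not change its `l`-past. -/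
theorem predecessor_append {l : ℕ} {μ ν : List A} (hμ : μ ∈ syncWords X l)
    (h : μ ++ ν ∈ language X) : predecessor X l (μ ++ ν) = predecessor X l μ := by
  ext b
  rw [mem_predecessor, mem_predecessor]
  rw [mem_syncWords] at hμ
  refine ⟨fun hb => ⟨hb.1, language_left (b := ν) (by simpa using hb.2)⟩, fun hb => ⟨hb.1, ?_⟩⟩
  simpa using hμ.2 b ν hb.1 hb.2 h

/-- If `ν ∈ S_k(X)` and `μ ν` is admissible with `k = |μ| + n`, then `μ ν ∈ S_n(X)`. -/
theorem append_mem_syncWords {n : ℕ} {μ ν : List A} (hν : ν ∈ syncWords X (μ.length + n))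
    (h : μ ++ ν ∈ language X) : μ ++ ν ∈ syncWords X n := by
  rw [mem_syncWords] at hν ⊢
  refine ⟨h, fun b c hb hbv hvc => ?_⟩
  have := hν.2 (b ++ μ) c (by simp [hb, add_comm]) (by simpa using hbv)
    (language_right (a := μ) (by simpa using hvc))
  simpa using this

theorem predecessor_eq_of_succ {l : ℕ} {μ ν : List A}
    (h : predecessor X (l + 1) μ = predecessor X (l + 1) ν) :
    predecessor X l μ = predecessor X l ν := by
  have key : ∀ {v : List A} {b : List A},
      b ∈ predecessor X l v ↔ ∃ a, a :: b ∈ predecessor X (l + 1) v := by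
    intro v b
    constructor
    · intro hb
      rw [mem_predecessor] at hb
      obtain ⟨a, ha⟩ := language_cons_extend hb.2
      exact ⟨a, mem_predecessor.2 ⟨by simp [hb.1], by simpa using ha⟩⟩
    · rintro ⟨a, ha⟩
      rw [mem_predecessor] at ha ⊢
      exact ⟨by simpa using ha.1, language_right (a := [a]) (by simpa using ha.2)⟩
  ext b
  rw [key, key, h]

theorem predecessor_cons_eq {l : ℕ} {α : A} {μ ν : List A}
    (h : predecessor X (l + 1) μ = predecessor X (l + 1) ν) :
    predecessor X l (α :: μ) = predecessor X l (α :: ν) := by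
  have key : ∀ {v : List A} {b : List A},
      b ∈ predecessor X l (α :: v) ↔ b ++ [α] ∈ predecessor X (l + 1) v := by
    intro v b
    rw [mem_predecessor, mem_predecessor]
    simp
  ext b
  rw [key, key, h]

theorem cons_mem_language_of_predecessor_eq {l : ℕ} {α : A} {μ ν : List A}
    (h : predecessor X (l + 1) μ = predecessor X (l + 1) ν) (hα : α :: μ ∈ language X) :
    α :: ν ∈ language X := by
  have hex : ∀ n : ℕ, ∃ b : List A, b.length = n ∧ b ++ (α :: μ) ∈ language X := by
    intro n
    induction n with
    | zero => exact ⟨[], rfl, by simpa using hα⟩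
    | succ n ih =>
      obtain ⟨b, hb, hb'⟩ := ih
      obtain ⟨a, ha⟩ := language_cons_extend hb'
      exact ⟨a :: b, by simp [hb], by simpa using ha⟩
  obtain ⟨b, hb, hb'⟩ := hex l
  have h1 : b ++ [α] ∈ predecessor X (l + 1) μ :=
    mem_predecessor.2 ⟨by simp [hb], by simpa using hb'⟩
  rw [h, mem_predecessor] at h1
  exact language_right (a := b) (by simpa using h1.2)

theorem Vertex.mk_eq_iff {l : ℕ} {μ ν : syncWords X l} :
    Vertex.mk X l μ = Vertex.mk X l ν ↔ predecessor X l μ.1 = predecessor X l ν.1 :=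
  Quotient.eq (r := pastSetoid X l)

theorem Vertex.exists_mk {l : ℕ} (v : Vertex X l) : ∃ μ, Vertex.mk X l μ = v :=
  Quotient.exists_rep (s := pastSetoid X l) v

/-- The map `[μ]_{l+1} ↦ [μ]_l`. -/
def Vertex.iota (X : Subshift A ℤ) (l : ℕ) : Vertex X (l + 1) → Vertex X l :=
  Quotient.lift (s := pastSetoid X (l + 1))
    (fun μ => Vertex.mk X l ⟨μ.1, syncWords_succ_subset l μ.2⟩)
    fun _ _ h => Vertex.mk_eq_iff.2 (predecessor_eq_of_succ h)

theorem Vertex.iota_mk {l : ℕ} (μ : syncWords X (l + 1)) :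
    Vertex.iota X l (Vertex.mk X (l + 1) μ) =
      Vertex.mk X l ⟨μ.1, syncWords_succ_subset l μ.2⟩ := rfl

theorem Vertex.iota_surjective (hX : IsLambdaSynchronizing X) (l : ℕ) :
    Function.Surjective (Vertex.iota X l) := by
  intro v
  obtain ⟨μ, rfl⟩ := v.exists_mk
  obtain ⟨ν, hν, hμν⟩ := hX μ.1 μ.2.1 (μ.1.length + (l + 1))
  refine ⟨Vertex.mk X (l + 1) ⟨μ.1 ++ ν, append_mem_syncWords hν hμν.2⟩, ?_⟩
  rw [Vertex.iota_mk, Vertex.mk_eq_iff]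
  exact predecessor_append μ.2 hμν.2

theorem Vertex.finite [Finite A] (l : ℕ) : Finite (Vertex X l) := by
  have hfin : {s : Set (List A) | s ⊆ {w : List A | w.length = l}}.Finite :=
    (List.finite_length_eq A l).finite_subsets
  have := hfin.to_subtype
  refine Finite.of_injective
    (β := {s : Set (List A) | s ⊆ {w : List A | w.length = l}})
    (fun v => Quotient.lift (s := pastSetoid X l)
      (fun μ => (⟨predecessor X l μ.1, fun b hb => hb.2.1⟩ :
        {s : Set (List A) | s ⊆ {w : List A | w.length = l}}))
      (fun _ _ h => Subtype.ext h) v) ?_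
  intro v w h
  obtain ⟨μ, rfl⟩ := v.exists_mk
  obtain ⟨ν, rfl⟩ := w.exists_mk
  exact Vertex.mk_eq_iff.2 (congrArg Subtype.val h)

theorem isEdge_mk_iff {l : ℕ} {u : Vertex X l} {α : A} {ν : syncWords X (l + 1)} :
    IsEdge X l u α (Vertex.mk X (l + 1) ν) ↔
      ∃ h : α :: ν.1 ∈ language X, u = Vertex.mk X l ⟨α :: ν.1, cons_mem_syncWords ν.2 h⟩ := by
  constructor
  · rintro ⟨⟨μ, hμ⟩, ν', h1, rfl, h3⟩
    rw [Vertex.mk_eq_iff] at h3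
    simp only at h1
    subst h1
    exact ⟨cons_mem_language_of_predecessor_eq h3.symm hμ.1,
      Vertex.mk_eq_iff.2 (predecessor_cons_eq h3.symm)⟩
  · rintro ⟨h, rfl⟩
    exact ⟨⟨α :: ν.1, cons_mem_syncWords ν.2 h⟩, ν, rfl, rfl, rfl⟩

/-- The edges of the `λ`-synchronizing `λ`-graph system: triples (source, label, target). -/
def Edge (X : Subshift A ℤ) (l : ℕ) : Type u :=
  {e : Vertex X l × A × Vertex X (l + 1) // IsEdge X l e.1 e.2.1 e.2.2}

theorem Edge.finite [Finite A] (l : ℕ) : Finite (Edge X l) := by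
  have := Vertex.finite (X := X)
  unfold Edge
  infer_instance

theorem edge_local_property (l : ℕ) (u : Vertex X l) (v : Vertex X (l + 2)) :
    ∃ f : {e : Edge X (l + 1) // e.1.2.2 = v ∧ Vertex.iota X l e.1.1 = u} ≃
        {e : Edge X l // e.1.1 = u ∧ e.1.2.2 = Vertex.iota X (l + 1) v},
      ∀ e, (f e).1.1.2.1 = e.1.1.2.1 := by
  obtain ⟨ν, rfl⟩ := v.exists_mk
  have hw : ∀ {w : Vertex X (l + 1)} {α : A}, IsEdge X (l + 1) w α (Vertex.mk X (l + 2) ν) →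
      IsEdge X l (Vertex.iota X l w) α (Vertex.iota X (l + 1) (Vertex.mk X (l + 2) ν)) := by
    intro w α h
    obtain ⟨hα, rfl⟩ := isEdge_mk_iff.1 h
    rw [Vertex.iota_mk, Vertex.iota_mk]
    exact isEdge_mk_iff.2 ⟨hα, rfl⟩
  let g : {e : Edge X (l + 1) // e.1.2.2 = Vertex.mk X (l + 2) ν ∧ Vertex.iota X l e.1.1 = u} →
      {e : Edge X l // e.1.1 = u ∧ e.1.2.2 = Vertex.iota X (l + 1) (Vertex.mk X (l + 2) ν)} :=
    fun e => ⟨⟨(u, e.1.1.2.1, Vertex.iota X (l + 1) (Vertex.mk X (l + 2) ν)), by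
      have h := e.1.2
      rw [e.2.1] at h
      have := hw h
      rwa [e.2.2] at this⟩, rfl, rfl⟩
  have hg : Function.Bijective g := by
    constructor
    · rintro ⟨⟨⟨w, α, v⟩, he⟩, h1, h2⟩ ⟨⟨⟨w', α', v'⟩, he'⟩, h1', h2'⟩ h
      simp only at h1 h2 h1' h2'
      have hα : α = α' := congrArg (fun e => e.1.1.2.1) h
      subst hα h1 h1'
      obtain ⟨_, hw1⟩ := isEdge_mk_iff.1 he
      obtain ⟨_, hw2⟩ := isEdge_mk_iff.1 he'
      have hww : w = w' := hw1.trans hw2.symm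
      subst hww
      rfl
    · rintro ⟨⟨⟨w, α, v⟩, he⟩, h1, h2⟩
      simp only at h1 h2
      subst h1 h2
      have he2 := he
      simp only [Vertex.iota_mk] at he2
      obtain ⟨h, hu⟩ := isEdge_mk_iff.1 he2
      refine ⟨⟨⟨(Vertex.mk X (l + 1) ⟨α :: ν.1, cons_mem_syncWords ν.2 h⟩, α,
        Vertex.mk X (l + 2) ν), isEdge_mk_iff.2 ⟨h, rfl⟩⟩, rfl, ?_⟩, rfl⟩
      rw [Vertex.iota_mk]
      exact hu.symm
  exact ⟨Equiv.ofBijective g hg, fun e => rfl⟩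

/-- The `λ`-synchronizing `λ`-graph system of a `λ`-synchronizing subshift. -/
def lambdaGraphSystem [Finite A] (X : Subshift A ℤ) (hX : IsLambdaSynchronizing X) :
    LambdaGraphSystem.{u} where
  Alphabet := A
  V := Vertex X
  finite_V := Vertex.finite
  E := Edge X
  finite_E := Edge.finite
  source := fun _ e => e.1.1
  target := fun _ e => e.1.2.2
  label := fun _ e => e.1.2.1
  ι := Vertex.iota X
  ι_surjective := Vertex.iota_surjective hX
  local_property := edge_local_property

end LambdaSystem

end LambdaSync

/-! A conjugacy lets one dynamical system `(Z, T)` carry both subshifts: `Z` is `X` with its shift,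
and `X`, `X'` are the sets of itineraries for two finite partitions of `Z`, by the coordinate 0 of a
point and by the coordinate 0 of its image. The matrix system is therefore attached to a partition,
and the question is what a change of partition does.

The vertices can be described without words. The `l`-past of a point consists of the points whose
symbols on `[-l, 0)` can precede its future; the point is regular if a finite prefix of the future
decides this past. Regular points are those whose future has an `l`-synchronizing prefix, and their
pasts correspond to the vertices of the `λ`-synchronizing system (`Codes.exists_vertex_map`). Hence
`Codes.oneStep` joins that system to `pastSystem`.

If one partition is `c ⊓ d` and another `d ⊓ c.comap T`, both group in pairs the same sequence `…,
c, d, c ∘ T, d ∘ T, …`, with offsets 0 and 1. Let `H` read one `c`-symbol and `K` one `d`-symbol.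
The four matrix identities then say that arrows between pasts compose and are compatible with
forgetting the oldest symbols (`arrow_comp`, `arrow_target_sat_iff`, `exists_sat_arrow_iff`); this
is `strongShiftEquivalentOneStep_bipartite`.

By compactness a conjugacy and its inverse have finite windows, so a finite widening of either
partition refines the other. Widening is a chain of bipartite steps, which links the two partitions
(`linked_of_iterate_widen_le`). -/

namespace LambdaSync

/-! ### Pasts of points with respect to a two-sided sequence of observables -/

section Observables

variable {Z : Type u}

/-- `x` and `y` agree on the observables `e i` with `m ≤ i < n`. -/
def Seg (e : ℤ → Setoid Z) (m n : ℤ) (x y : Z) : Prop :=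
  ∀ i, m ≤ i → i < n → (e i).r x y

/-- `x` and `y` agree on the observables `e i` with `n ≤ i`. -/
def Fut (e : ℤ → Setoid Z) (n : ℤ) (x y : Z) : Prop :=
  ∀ i, n ≤ i → (e i).r x y

/-- The points whose `[m, n)`-segment can precede the `[n, ∞)`-future of `x`. -/
def past (e : ℤ → Setoid Z) (m n : ℤ) (x : Z) : Set Z :=
  {z | ∃ y, Fut e n x y ∧ Seg e m n y z}

/-- The `[m, n)`-past is locally constant at the `[n, ∞)`-future of `x`. -/
def Reg (e : ℤ → Setoid Z) (m n : ℤ) (x : Z) : Prop :=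
  ∃ N, ∀ y, Seg e n N x y → past e m n y = past e m n x

/-- The pasts of regular points. -/
def IsVertex (e : ℤ → Setoid Z) (m n : ℤ) (S : Set Z) : Prop :=
  ∃ x, Reg e m n x ∧ past e m n x = S

/-- The saturation of a set under agreement on `[m, n)`. -/
def sat (e : ℤ → Setoid Z) (m n : ℤ) (S : Set Z) : Set Z :=
  {z | ∃ y ∈ S, Seg e m n y z}

/-- The `λ`-synchronization property of a sequence of observables. -/
def IsSync (e : ℤ → Setoid Z) : Prop :=
  ∀ (m n N : ℤ) (x : Z), n ≤ N → ∃ y, Seg e n N x y ∧ Reg e m N y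

/-- A point with label in `L` that leads from the `[m, n)`-past `U` to the
`[m', n')`-past `W`. -/
def Arrow (e : ℤ → Setoid Z) (L : Set Z) (m n m' n' : ℤ) (U W : Set Z) : Prop :=
  ∃ x ∈ L, Reg e m' n' x ∧ past e m n x = U ∧ past e m' n' x = W

variable {e : ℤ → Setoid Z} {m m' m₁ m₂ n n' n₁ n₂ : ℤ} {x y z : Z} {L L' U V W : Set Z}

theorem Seg.refl (x : Z) : Seg e m n x x := fun i _ _ => (e i).refl x

theorem Seg.symm (h : Seg e m n x y) : Seg e m n y x := fun i h1 h2 => (e i).symm (h i h1 h2)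

theorem Seg.trans (h : Seg e m n x y) (h' : Seg e m n y z) : Seg e m n x z :=
  fun i h1 h2 => (e i).trans (h i h1 h2) (h' i h1 h2)

theorem Seg.mono (h : Seg e m n x y) (hm : m ≤ m') (hn : n' ≤ n) : Seg e m' n' x y :=
  fun i h1 h2 => h i (hm.trans h1) (h2.trans_le hn)

theorem Fut.refl (x : Z) : Fut e n x x := fun i _ => (e i).refl x

theorem Fut.symm (h : Fut e n x y) : Fut e n y x := fun i h1 => (e i).symm (h i h1)

theorem Fut.trans (h : Fut e n x y) (h' : Fut e n y z) : Fut e n x z :=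
  fun i h1 => (e i).trans (h i h1) (h' i h1)

theorem Fut.mono (h : Fut e n x y) (hn : n ≤ n') : Fut e n' x y :=
  fun i h1 => h i (hn.trans h1)

theorem Fut.seg (h : Fut e n x y) : Seg e n n' x y := fun i h1 _ => h i h1

theorem Fut.extend (h : Fut e n x y) (h' : Seg e n' n x y) : Fut e n' x y := fun i hi => by
  rcases lt_or_ge i n with h1 | h1
  · exact h' i hi h1
  · exact h i h1

theorem past_congr (h : Fut e n x y) : past e m n x = past e m n y := by
  ext z
  exact ⟨fun ⟨w, h1, h2⟩ => ⟨w, h.symm.trans h1, h2⟩, fun ⟨w, h1, h2⟩ => ⟨w, h.trans h1, h2⟩⟩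

theorem Reg.congr (hx : Reg e m n x) (h : Fut e n x y) : Reg e m n y := by
  obtain ⟨N, hN⟩ := hx
  exact ⟨N, fun w hw => (hN w (h.seg.trans hw)).trans (past_congr h)⟩

theorem mem_past_self (x : Z) : x ∈ past e m n x := ⟨x, Fut.refl x, Seg.refl x⟩

/-- A shorter past forgets the oldest symbols, so it is a function of the longer one. This function
is the map `ι` between vertices. -/
theorem sat_past (h : m ≤ m') : sat e m' n (past e m n x) = past e m' n x := by
  ext z
  constructor
  · rintro ⟨y, ⟨w, h1, h2⟩, h3⟩
    exact ⟨w, h1, (h2.mono h le_rfl).trans h3⟩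
  · rintro ⟨w, h1, h2⟩
    exact ⟨w, ⟨w, h1, Seg.refl w⟩, h2⟩

theorem past_mono (hm : m ≤ m') (h : past e m n x = past e m n y) :
    past e m' n x = past e m' n y := by
  rw [← sat_past hm, h, sat_past hm]

theorem Reg.mono (hx : Reg e m n x) (hm : m ≤ m') : Reg e m' n x := by
  obtain ⟨N, hN⟩ := hx
  exact ⟨N, fun y hy => past_mono hm (hN y hy)⟩

/-- The past of a shorter future is determined by the past of a longer one and the symbols in
between. -/
theorem past_left (hm : m ≤ n') (hn : n' ≤ n) (h : past e m n x = past e m n y)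
    (hs : Seg e n' n x y) : past e m n' x = past e m n' y := by
  have key : ∀ {x y : Z}, past e m n x = past e m n y → Seg e n' n x y →
      past e m n' x ⊆ past e m n' y := by
    rintro x y h hs z ⟨w, h1, h2⟩
    have hw : w ∈ past e m n x := ⟨w, h1.mono hn, Seg.refl w⟩
    rw [h] at hw
    obtain ⟨w', h3, h4⟩ := hw
    refine ⟨w', h3.extend ?_, (h4.mono le_rfl hn).trans h2⟩
    exact hs.symm.trans (h1.seg.trans (h4.mono hm le_rfl).symm)
  exact (key h hs).antisymm (key h.symm hs.symm)

theorem Reg.left (hx : Reg e m n x) (hm : m ≤ n') (hn : n' ≤ n) : Reg e m n' x := by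
  obtain ⟨N, hN⟩ := hx
  -- The window has to reach `n`, so that the symbols on `[n', n)` are fixed as well.
  refine ⟨max N n, fun y hy => past_left hm hn (hN y (hy.mono hn (le_max_left _ _))) ?_⟩
  exact (hy.mono le_rfl (le_max_right _ _)).symm

theorem Reg.isVertex (hx : Reg e m n x) : IsVertex e m n (past e m n x) := ⟨x, hx, rfl⟩

theorem IsVertex.sat (hU : IsVertex e m n U) (h : m ≤ m') : IsVertex e m' n (sat e m' n U) := by
  obtain ⟨x, hx, rfl⟩ := hU
  exact ⟨x, hx.mono h, (sat_past h).symm⟩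

/-- A locally constant past is decided by a finite window, and synchronization offers a point with
the same window that is regular for a longer past. Surjectivity of `ι` follows. -/
theorem IsSync.exists_reg (h : IsSync e) (hx : Reg e m n x) (hm : m' ≤ n) :
    ∃ y, Reg e m' n y ∧ past e m n y = past e m n x := by
  obtain ⟨N, hN⟩ := hx
  obtain ⟨y, hy, hr⟩ := h m' n (max N n) x (le_max_right _ _)
  exact ⟨y, hr.left hm (le_max_right _ _), hN y (hy.mono le_rfl (le_max_left _ _))⟩

theorem IsSync.exists_sat_eq (h : IsSync e) (hU : IsVertex e m n U) (hm : m' ≤ m) (hn : m ≤ n) :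
    ∃ V, IsVertex e m' n V ∧ LambdaSync.sat e m n V = U := by
  obtain ⟨x, hx, rfl⟩ := hU
  obtain ⟨y, hy, hxy⟩ := h.exists_reg hx (hm.trans hn)
  exact ⟨_, hy.isVertex, by rw [sat_past hm, hxy]⟩

/-- A point with the future of `x₂` and the past of `x₁`. -/
theorem exists_glue {x₁ x₂ : Z} (h : past e m n x₁ = past e m n x₂) (hm : m ≤ m₁)
    (hmn : m₁ ≤ n₁) (hn : n₁ ≤ n) :
    ∃ x, Fut e n x₂ x ∧ Seg e m n x x₁ ∧ past e m₁ n₁ x = past e m₁ n₁ x₁ := by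
  have hx : x₁ ∈ past e m n x₂ := h ▸ mem_past_self x₁
  obtain ⟨x, h1, h2⟩ := hx
  -- The glued point shares with `x₁` both the `[m, n)`-past and the symbols on `[m, n)`, hence the
  -- pasts on subintervals.
  refine ⟨x, h1, h2, past_left hmn hn (past_mono hm ?_) (h2.mono (hm.trans hmn) le_rfl)⟩
  rw [← past_congr h1, h]

/-- Arrows are left-resolving: the past at the source can be read off from the past at the target
and the symbols on `[n, n')`, which the label fixes. -/
theorem Arrow.left_unique (hU : Arrow e L m n m' n' U W) (hV : Arrow e L m n m' n' V W)
    (hL : ∀ x ∈ L, ∀ y ∈ L, Seg e n n' x y) (h1 : m' ≤ m) (h2 : m ≤ n) (h3 : n ≤ n') :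
    U = V := by
  obtain ⟨x, hx, -, rfl, hxW⟩ := hU
  obtain ⟨y, hy, -, rfl, hyW⟩ := hV
  exact past_left h2 h3 (past_mono h1 (hxW.trans hyW.symm)) (hL x hx y hy)

/-- Two arrows that meet in `V` are glued at `n₁` into one point, which keeps the source of the
first and the future of the second. Conversely the intermediate past of a single point is regular
because its later, longer past is. -/
theorem arrow_comp (h1 : m₂ ≤ m₁) (h2 : m₁ ≤ m) (h3 : m ≤ n) (h4 : n ≤ n₁) (h5 : n₁ ≤ n₂)
    (hL : ∀ x ∈ L, ∀ y, Seg e n n₁ x y → y ∈ L)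
    (hL' : ∀ x ∈ L', ∀ y, Seg e n₁ n₂ x y → y ∈ L') :
    (∃ V, IsVertex e m₁ n₁ V ∧ Arrow e L m n m₁ n₁ U V ∧ Arrow e L' m₁ n₁ m₂ n₂ V W) ↔
      Arrow e (L ∩ L') m n m₂ n₂ U W := by
  constructor
  · rintro ⟨V, -, ⟨x, hx, hxr, rfl, hxV⟩, ⟨y, hy, hyr, hyV, rfl⟩⟩
    obtain ⟨z, hz1, hz2, hz3⟩ := exists_glue (hxV.trans hyV.symm) h2 h3 h4
    refine ⟨z, ⟨hL x hx z (hz2.mono (h2.trans h3) le_rfl).symm, hL' y hy z hz1.seg⟩,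
      hyr.congr (hz1.mono h5), hz3, (past_congr (hz1.mono h5)).symm⟩
  · rintro ⟨x, hx, hxr, rfl, rfl⟩
    have hr := (hxr.mono h1).left (h2.trans (h3.trans h4)) h5
    exact ⟨_, hr.isVertex, ⟨x, hx.1, hr, rfl, rfl⟩, ⟨x, hx.2, hxr, rfl, rfl⟩⟩

/-- Refining the target neither creates nor destroys arrows: the future can be exchanged for that of
a regular representative of `W`, and gluing preserves source and label. -/
theorem arrow_target_sat_iff (h : m₂ ≤ m') (hW : IsVertex e m₂ n' W)
    (h1 : m' ≤ m) (h2 : m ≤ n) (h3 : n ≤ n') (hL : ∀ x ∈ L, ∀ y, Seg e n n' x y → y ∈ L) :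
    Arrow e L m n m' n' U (sat e m' n' W) ↔ Arrow e L m n m₂ n' U W := by
  obtain ⟨w, hw, rfl⟩ := hW
  rw [sat_past h]
  constructor
  · rintro ⟨x, hx, hxr, rfl, hxw⟩
    obtain ⟨z, hz1, hz2, hz3⟩ := exists_glue hxw h1 h2 h3
    exact ⟨z, hL x hx z (hz2.mono (h1.trans h2) le_rfl).symm, hw.congr hz1, hz3,
      (past_congr hz1).symm⟩
  · rintro ⟨x, hx, hxr, rfl, hxw⟩
    exact ⟨x, hx, hxr.mono h, rfl, past_mono h hxw⟩

/-- The counterpart at the source. With `arrow_target_sat_iff` it yields every commutation with `ι`.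
-/
theorem exists_sat_arrow_iff (h1 : m₂ ≤ m₁) (h2 : m₁ ≤ m) (h3 : m ≤ n) (h4 : n ≤ n') :
    (∃ V, IsVertex e m₁ n V ∧ sat e m n V = U ∧ Arrow e L m₁ n m₂ n' V W) ↔
      Arrow e L m n m₂ n' U W := by
  constructor
  · rintro ⟨V, -, rfl, x, hx, hxr, rfl, rfl⟩
    exact ⟨x, hx, hxr, (sat_past h2).symm, rfl⟩
  · rintro ⟨x, hx, hxr, rfl, rfl⟩
    exact ⟨_, ((hxr.mono h1).left (h2.trans h3) h4).isVertex, sat_past h2, x, hx, hxr, rfl, rfl⟩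

theorem exists_arrow_iff {A B : Type*} (f : Z → A) (φ : A → B) (b : B) :
    (∃ a, Arrow e {x | f x = a} m n m' n' U W ∧ φ a = b) ↔
      Arrow e {x | φ (f x) = b} m n m' n' U W := by
  constructor
  · rintro ⟨_, ⟨x, rfl, h⟩, hb⟩
    exact ⟨x, hb, h⟩
  · rintro ⟨x, hb, h⟩
    exact ⟨f x, ⟨x, rfl, h⟩, hb⟩

/-! ### Translation of the index by the dynamics -/

section Shift

variable {T : Equiv.Perm Z} {p : ℤ}

theorem seg_add_iff (hT : ∀ i x y, (e (i + p)).r x y ↔ (e i).r (T x) (T y)) :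
    Seg e (m + p) (n + p) x y ↔ Seg e m n (T x) (T y) := by
  constructor
  · intro h i h1 h2
    exact (hT i x y).1 (h (i + p) (by omega) (by omega))
  · intro h i h1 h2
    have := (hT (i - p) x y).2 (h (i - p) (by omega) (by omega))
    rwa [sub_add_cancel] at this

theorem fut_add_iff (hT : ∀ i x y, (e (i + p)).r x y ↔ (e i).r (T x) (T y)) :
    Fut e (n + p) x y ↔ Fut e n (T x) (T y) := by
  constructor
  · intro h i h1
    exact (hT i x y).1 (h (i + p) (by omega))
  · intro h i h1
    have := (hT (i - p) x y).2 (h (i - p) (by omega))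
    rwa [sub_add_cancel] at this

theorem past_add (hT : ∀ i x y, (e (i + p)).r x y ↔ (e i).r (T x) (T y)) :
    past e (m + p) (n + p) x = T ⁻¹' past e m n (T x) := by
  ext z
  constructor
  · rintro ⟨y, h1, h2⟩
    exact ⟨T y, (fut_add_iff hT).1 h1, (seg_add_iff hT).1 h2⟩
  · rintro ⟨y, h1, h2⟩
    obtain ⟨y, rfl⟩ := T.surjective y
    exact ⟨y, (fut_add_iff hT).2 h1, (seg_add_iff hT).2 h2⟩

theorem reg_add_iff (hT : ∀ i x y, (e (i + p)).r x y ↔ (e i).r (T x) (T y)) :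
    Reg e (m + p) (n + p) x ↔ Reg e m n (T x) := by
  constructor
  · rintro ⟨N, hN⟩
    refine ⟨N - p, fun y hy => ?_⟩
    obtain ⟨y, rfl⟩ := T.surjective y
    have := hN y (by rw [← seg_add_iff hT, sub_add_cancel] at hy; exact hy)
    rw [past_add hT, past_add hT] at this
    exact T.surjective.preimage_injective this
  · rintro ⟨N, hN⟩
    refine ⟨N + p, fun y hy => ?_⟩
    rw [past_add hT, past_add hT, hN (T y) ((seg_add_iff hT).1 hy)]

theorem isVertex_shift_iff (hT : ∀ i x y, (e (i + p)).r x y ↔ (e i).r (T x) (T y))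
    (hm : m₁ = m + p) (hn : n₁ = n + p) :
    IsVertex e m₁ n₁ (T ⁻¹' U) ↔ IsVertex e m n U := by
  subst hm hn
  constructor
  · rintro ⟨x, hx, h⟩
    rw [past_add hT] at h
    exact ⟨T x, (reg_add_iff hT).1 hx, T.surjective.preimage_injective h⟩
  · rintro ⟨x, hx, rfl⟩
    obtain ⟨x, rfl⟩ := T.surjective x
    exact ⟨x, (reg_add_iff hT).2 hx, past_add hT⟩

theorem sat_shift (hT : ∀ i x y, (e (i + p)).r x y ↔ (e i).r (T x) (T y))
    (hm : m₁ = m + p) (hn : n₁ = n + p) :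
    sat e m₁ n₁ (T ⁻¹' U) = T ⁻¹' sat e m n U := by
  subst hm hn
  ext z
  constructor
  · rintro ⟨y, h1, h2⟩
    exact ⟨T y, h1, (seg_add_iff hT).1 h2⟩
  · rintro ⟨y, h1, h2⟩
    obtain ⟨y, rfl⟩ := T.surjective y
    exact ⟨y, h1, (seg_add_iff hT).2 h2⟩

theorem arrow_shift_iff (hT : ∀ i x y, (e (i + p)).r x y ↔ (e i).r (T x) (T y))
    (hm : m₁ = m + p) (hn : n₁ = n + p)
    (hm' : m₂ = m' + p) (hn' : n₂ = n' + p) :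
    Arrow e (T ⁻¹' L) m₁ n₁ m₂ n₂ (T ⁻¹' U) (T ⁻¹' W) ↔
      Arrow e L m n m' n' U W := by
  subst hm hn hm' hn'
  constructor
  · rintro ⟨x, hx, hr, h1, h2⟩
    rw [past_add hT] at h1 h2
    exact ⟨T x, hx, (reg_add_iff hT).1 hr, T.surjective.preimage_injective h1,
      T.surjective.preimage_injective h2⟩
  · rintro ⟨x, hx, hr, rfl, rfl⟩
    obtain ⟨x, rfl⟩ := T.surjective x
    exact ⟨x, hx, (reg_add_iff hT).2 hr, past_add hT, past_add hT⟩

end Shift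

end Observables

/-! ### Symbolic matrices of resolving relations -/

section Relations

variable {A C D m n p : Type u}

open Classical in
/-- The formal sum of the symbols with a given property. -/
noncomputable def labels [Finite A] (P : A → Prop) : Multiset A :=
  (Set.toFinite {a | P a}).toFinset.val

open Classical in
theorem count_labels [Finite A] (P : A → Prop) (a : A) :
    (labels P).count a = if P a then 1 else 0 := by
  unfold labels
  rw [Multiset.count_eq_of_nodup (Finset.nodup _)]
  simp

open Classical in
theorem eq_labels_iff [Finite A] {P : A → Prop} {s : Multiset A} :
    s = labels P ↔ ∀ a, s.count a = if P a then 1 else 0 := by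
  simp [Multiset.ext, count_labels]

open Classical in
theorem count_labels_product [Finite C] [Finite D] (P : C → Prop) (Q : D → Prop) (cd : C × D) :
    (labels P ×ˢ labels Q).count cd = if P cd.1 ∧ Q cd.2 then 1 else 0 := by
  unfold labels
  rw [Multiset.count_eq_of_nodup (Multiset.Nodup.product (Finset.nodup _) (Finset.nodup _))]
  simp [Multiset.mem_product]

theorem labels_congr [Finite A] {P Q : A → Prop} (h : ∀ a, P a ↔ Q a) : labels P = labels Q :=
  congrArg labels (funext fun a => propext (h a))

theorem map_labels [Finite A] [Finite C] {φ : A → C} (hφ : Function.Injective φ) (P : A → Prop) :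
    (labels P).map φ = labels fun c => ∃ a, P a ∧ φ a = c := by
  refine (Multiset.Nodup.ext ((Finset.nodup _).map hφ) (Finset.nodup _)).2 fun c => ?_
  simp

/-- For resolving relations at most one intermediate vertex contributes to an entry of a product, so
products stay free of multiplicities and are again matrices of relations. -/
theorem sum_ite_of_unique [Fintype n] (P : n → Prop) [DecidablePred P] {_x : Decidable (∃ i, P i)}
    (h : ∀ i j, P i → P j → i = j) :
    (∑ i, if P i then 1 else 0) = if ∃ i, P i then 1 else 0 := by
  by_cases hP : ∃ i, P i
  · obtain ⟨i, hi⟩ := hP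
    rw [Finset.sum_eq_single i, if_pos hi, if_pos ⟨i, hi⟩]
    · intro j _ hj
      exact if_neg fun h' => hj (h j i h' hi)
    · simp
  · rw [if_neg hP]
    exact Finset.sum_eq_zero fun i _ => if_neg fun h' => hP ⟨i, h'⟩

/-- The symbolic matrix of a labeled relation. -/
noncomputable def relMatrix [Finite A] (R : m → A → n → Prop) : Matrix m n (Multiset A) :=
  fun u v => labels fun a => R u a v

open Classical in
/-- The matrix of a map. -/
noncomputable def mapMatrix (f : n → m) : Matrix m n ℕ :=
  fun u v => if f v = u then 1 else 0

theorem natMulSym_relMatrix [Fintype n] [Finite A] (f : n → m) {R : n → A → p → Prop}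
    (hR : ∀ a w u u', R u a w → R u' a w → u = u') :
    natMulSym (mapMatrix f) (relMatrix R) = relMatrix fun u a w => ∃ v, f v = u ∧ R v a w := by
  classical
  funext u w
  refine eq_labels_iff.2 fun a => ?_
  refine Eq.trans ?_ (sum_ite_of_unique (fun v => f v = u ∧ R v a w)
    fun i j hi hj => hR a w i j hi.2 hj.2)
  simp only [natMulSym, Multiset.count_sum', Multiset.count_nsmul, relMatrix, count_labels,
    mapMatrix]
  refine Finset.sum_congr rfl fun v _ => ?_
  by_cases h1 : f v = u <;> by_cases h2 : R v a w <;> simp [h1, h2]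

theorem symMulNat_relMatrix [Fintype n] [Finite A] (f : p → n) (R : m → A → n → Prop) :
    symMulNat (relMatrix R) (mapMatrix f) = relMatrix fun u a w => R u a (f w) := by
  classical
  funext u w
  simp only [symMulNat, mapMatrix]
  rw [Finset.sum_eq_single (f w)]
  · simp [relMatrix]
  · intro v _ hv
    rw [if_neg hv.symm, zero_smul]
  · simp

theorem symMulSym_relMatrix [Fintype n] [Finite C] [Finite D] {R : m → C → n → Prop}
    {Q : n → D → p → Prop} (hQ : ∀ d w u u', Q u d w → Q u' d w → u = u') :
    symMulSym (relMatrix R) (relMatrix Q) =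
      relMatrix fun u (cd : C × D) w => ∃ v, R u cd.1 v ∧ Q v cd.2 w := by
  classical
  funext u w
  refine eq_labels_iff.2 fun cd => ?_
  refine Eq.trans ?_ (sum_ite_of_unique (fun v => R u cd.1 v ∧ Q v cd.2 w)
    fun i j hi hj => hQ cd.2 w i j hi.2 hj.2)
  simp only [symMulSym, Multiset.count_sum']
  refine Finset.sum_congr rfl fun v _ => ?_
  convert count_labels_product (fun c => R u c v) (fun d => Q v d w) cd
  · rfl
  · rfl

theorem relabel_relMatrix [Finite A] [Finite C] {φ : A → C} (hφ : Function.Injective φ)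
    (R : m → A → n → Prop) :
    relabel φ (relMatrix R) = relMatrix fun u c w => ∃ a, R u a w ∧ φ a = c := by
  funext u w
  exact map_labels hφ _

end Relations

/-! ### Strong shift equivalence through relations -/

/-- The matrices of `S` are those of the labeled relations `R` and of the maps `ι`, and each
vertex is determined by an outgoing edge through its label and target. -/
structure SymbolicMatrixSystem.IsPresentedBy (S : SymbolicMatrixSystem.{u})
    (R : ∀ l, S.Index l → S.Alphabet → S.Index (l + 1) → Prop)
    (ι : ∀ l, S.Index (l + 1) → S.Index l) : Prop where
  M_eq : ∀ l, S.M l = relMatrix (R l)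
  I_eq : ∀ l, S.I l = mapMatrix (ι l)
  resolving : ∀ l a w u u', R l u a w → R l u' a w → u = u'

theorem StrongShiftEquivalentOneStep.symm {S S' : SymbolicMatrixSystem.{u}}
    (h : StrongShiftEquivalentOneStep S S') : StrongShiftEquivalentOneStep S' S := by
  obtain ⟨C, D, hC, hD, φ, φ', H, K, h1, h2, h3⟩ := h
  exact ⟨D, C, hD, hC, φ', φ, K, H, h2, h1,
    fun l => ⟨(h3 l).2.1, (h3 l).1, (h3 l).2.2.2, (h3 l).2.2.1⟩⟩

theorem strongShiftEquivalentOneStep_of_relations {S S' : SymbolicMatrixSystem.{u}}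
    {R : ∀ l, S.Index l → S.Alphabet → S.Index (l + 1) → Prop}
    {ι : ∀ l, S.Index (l + 1) → S.Index l}
    {R' : ∀ l, S'.Index l → S'.Alphabet → S'.Index (l + 1) → Prop}
    {ι' : ∀ l, S'.Index (l + 1) → S'.Index l}
    (hS : S.IsPresentedBy R ι) (hS' : S'.IsPresentedBy R' ι')
    {C D : Type u} [Finite C] [Finite D] {φ : S.Alphabet → C × D} {φ' : S'.Alphabet → D × C}
    (hφ : Function.Injective φ) (hφ' : Function.Injective φ')
    (H : ∀ l, S.Index l → C → S'.Index (l + 1) → Prop)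
    (K : ∀ l, S'.Index l → D → S.Index (l + 1) → Prop)
    (hH : ∀ l c w u u', H l u c w → H l u' c w → u = u')
    (hK : ∀ l d w u u', K l u d w → K l u' d w → u = u')
    (hHK : ∀ l u c d w, (∃ a, (∃ v, ι l v = u ∧ R (l + 1) v a w) ∧ φ a = (c, d)) ↔
      ∃ v, H l u c v ∧ K (l + 1) v d w)
    (hKH : ∀ l u d c w, (∃ a, (∃ v, ι' l v = u ∧ R' (l + 1) v a w) ∧ φ' a = (d, c)) ↔
      ∃ v, K l u d v ∧ H (l + 1) v c w)
    (hHι : ∀ l u c w, H l u c (ι' (l + 1) w) ↔ ∃ v, ι l v = u ∧ H (l + 1) v c w)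
    (hKι : ∀ l u d w, K l u d (ι (l + 1) w) ↔ ∃ v, ι' l v = u ∧ K (l + 1) v d w) :
    StrongShiftEquivalentOneStep S S' := by
  refine ⟨C, D, inferInstance, inferInstance, φ, φ', fun l => relMatrix (H l),
    fun l => relMatrix (K l), hφ, hφ', fun l => ⟨?_, ?_, ?_, ?_⟩⟩
  · rw [hS.I_eq, hS.M_eq, natMulSym_relMatrix _ (hS.resolving _), relabel_relMatrix hφ,
      symMulSym_relMatrix (hK _)]
    funext u w
    exact labels_congr fun cd => hHK l u cd.1 cd.2 w
  · rw [hS'.I_eq, hS'.M_eq, natMulSym_relMatrix _ (hS'.resolving _), relabel_relMatrix hφ',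
      symMulSym_relMatrix (hH _)]
    funext u w
    exact labels_congr fun dc => hKH l u dc.1 dc.2 w
  · rw [hS'.I_eq, symMulNat_relMatrix, hS.I_eq, natMulSym_relMatrix _ (hH _)]
    funext u w
    exact labels_congr fun c => hHι l u c w
  · rw [hS.I_eq, symMulNat_relMatrix, hS'.I_eq, natMulSym_relMatrix _ (hK _)]
    funext u w
    exact labels_congr fun d => hKι l u d w

/-- Presented systems that differ by a bijection of the vertices and an injection of the alphabet
are strong shift equivalent in one step. -/
theorem strongShiftEquivalentOneStep_of_bijective {S S' : SymbolicMatrixSystem.{u}}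
    {R : ∀ l, S.Index l → S.Alphabet → S.Index (l + 1) → Prop}
    {ι : ∀ l, S.Index (l + 1) → S.Index l}
    {R' : ∀ l, S'.Index l → S'.Alphabet → S'.Index (l + 1) → Prop}
    {ι' : ∀ l, S'.Index (l + 1) → S'.Index l}
    (hS : S.IsPresentedBy R ι) (hS' : S'.IsPresentedBy R' ι')
    (hcomm : ∀ l u a w, R l u a (ι (l + 1) w) ↔ ∃ v, ι l v = u ∧ R (l + 1) v a w)
    (f : ∀ l, S'.Index l → S.Index l) (hf : ∀ l, Function.Bijective (f l))
    (g : S'.Alphabet → S.Alphabet) (hg : Function.Injective g)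
    (hι : ∀ l v, f l (ι' l v) = ι l (f (l + 1) v))
    (hR' : ∀ l u a w, R' l u a w → R l (f l u) (g a) (f (l + 1) w))
    (hR : ∀ l u b w, R l (f l u) b (f (l + 1) w) → ∃ a, g a = b ∧ R' l u a w) :
    StrongShiftEquivalentOneStep S S' := by
  -- `H` carries an edge of `S` whose target is transported by `f`, and `K` carries `ι` over a
  -- one-letter alphabet; `H K` is thus an edge followed by `ι`.
  refine strongShiftEquivalentOneStep_of_relations hS hS' (C := S.Alphabet) (D := PUnit)
    (φ := fun a => (a, PUnit.unit)) (φ' := fun a => (PUnit.unit, g a))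
    (fun a b h => congrArg Prod.fst h) (fun a b h => hg (congrArg Prod.snd h))
    (fun l u a w => R l u a (f (l + 1) w)) (fun l u _ w => f l u = ι l w)
    (fun l c w u u' h h' => hS.resolving _ _ _ _ _ h h')
    (fun l d w u u' h h' => (hf l).1 (h.trans h'.symm)) ?_ ?_ ?_ ?_
  · intro l u c d w
    constructor
    · rintro ⟨a, h, h'⟩
      obtain rfl : a = c := congrArg Prod.fst h'
      obtain ⟨v, hv⟩ := (hf (l + 1)).2 (ι (l + 1) w)
      exact ⟨v, by rw [hv, hcomm]; exact h, hv⟩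
    · rintro ⟨v, h, hv⟩
      rw [hv, hcomm] at h
      exact ⟨c, h, rfl⟩
  · intro l u d c w
    constructor
    · rintro ⟨a, ⟨v, rfl, hv⟩, h'⟩
      obtain rfl : g a = c := congrArg Prod.snd h'
      exact ⟨f (l + 1) v, hι l v, hR' _ _ _ _ hv⟩
    · rintro ⟨v, h, hv⟩
      obtain ⟨v, rfl⟩ := (hf (l + 1)).2 v
      obtain ⟨a, rfl, ha⟩ := hR _ _ _ _ hv
      exact ⟨a, ⟨v, (hf l).1 ((hι l v).trans h.symm), ha⟩, rfl⟩
  · intro l u c w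
    rw [hι, hcomm]
  · intro l u d w
    constructor
    · intro h
      obtain ⟨v, hv⟩ := (hf (l + 1)).2 (ι (l + 1) w)
      exact ⟨v, (hf l).1 (by rw [hι, hv, h]), hv⟩
    · rintro ⟨v, rfl, hv⟩
      rw [hι, hv]

/-! ### Blocking of observables -/

section Reindex

variable {Z : Type u} {e e' : ℤ → Setoid Z} {r : ℤ}

section

variable {m n m' n' : ℤ} {x y : Z} {U W L : Set Z}

/-- The sequence `e'` groups `e` in consecutive pairs with offset `r`, so intervals of `e'` are the
intervals of `e` whose endpoints have the parity of `r`. -/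
theorem seg_reindex
    (h : ∀ i x y, (e' i).r x y ↔ (e (2 * i + r)).r x y ∧ (e (2 * i + r + 1)).r x y) :
    Seg e' m n x y ↔ Seg e (2 * m + r) (2 * n + r) x y := by
  constructor
  · intro hs i h1 h2
    have hi := (h ((i - r) / 2) x y).1 (hs _ (by omega) (by omega))
    rcases Int.emod_two_eq_zero_or_one (i - r) with h3 | h3
    · have := hi.1
      rwa [show 2 * ((i - r) / 2) + r = i by omega] at this
    · have := hi.2
      rwa [show 2 * ((i - r) / 2) + r + 1 = i by omega] at this
  · intro hs i h1 h2
    exact (h i x y).2 ⟨hs _ (by omega) (by omega), hs _ (by omega) (by omega)⟩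

theorem fut_reindex
    (h : ∀ i x y, (e' i).r x y ↔ (e (2 * i + r)).r x y ∧ (e (2 * i + r + 1)).r x y) :
    Fut e' n x y ↔ Fut e (2 * n + r) x y := by
  constructor
  · intro hs i h1
    have hs' : Seg e' n ((i - r) / 2 + 1) x y := hs.seg
    exact (seg_reindex h).1 hs' i h1 (by omega)
  · intro hs i h1
    exact (h i x y).2 ⟨hs _ (by omega), hs _ (by omega)⟩

theorem past_reindex
    (h : ∀ i x y, (e' i).r x y ↔ (e (2 * i + r)).r x y ∧ (e (2 * i + r + 1)).r x y) :
    past e' m n x = past e (2 * m + r) (2 * n + r) x := by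
  ext z
  exact exists_congr fun y => and_congr (fut_reindex h) (seg_reindex h)

theorem reg_reindex
    (h : ∀ i x y, (e' i).r x y ↔ (e (2 * i + r)).r x y ∧ (e (2 * i + r + 1)).r x y) :
    Reg e' m n x ↔ Reg e (2 * m + r) (2 * n + r) x := by
  constructor
  · rintro ⟨N, hN⟩
    refine ⟨2 * N + r, fun y hy => ?_⟩
    rw [← past_reindex h, ← past_reindex h]
    exact hN y ((seg_reindex h).2 hy)
  · rintro ⟨N, hN⟩
    -- Rounded up, so that the whole pairs cover the window that ends at `N`.
    refine ⟨(N - r) / 2 + 1, fun y hy => ?_⟩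
    rw [past_reindex h, past_reindex h]
    exact hN y (((seg_reindex h).1 hy).mono le_rfl (by omega))

theorem isVertex_reindex
    (h : ∀ i x y, (e' i).r x y ↔ (e (2 * i + r)).r x y ∧ (e (2 * i + r + 1)).r x y)
    (hm : m' = 2 * m + r) (hn : n' = 2 * n + r) :
    IsVertex e' m n U ↔ IsVertex e m' n' U := by
  subst hm hn
  exact exists_congr fun x => and_congr (reg_reindex h) (by rw [past_reindex h])

theorem sat_reindex
    (h : ∀ i x y, (e' i).r x y ↔ (e (2 * i + r)).r x y ∧ (e (2 * i + r + 1)).r x y)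
    (hm : m' = 2 * m + r) (hn : n' = 2 * n + r) : sat e' m n U = sat e m' n' U := by
  subst hm hn
  ext z
  exact exists_congr fun y => and_congr Iff.rfl (seg_reindex h)

theorem arrow_reindex {m₁ n₁ m₁' n₁' : ℤ}
    (h : ∀ i x y, (e' i).r x y ↔ (e (2 * i + r)).r x y ∧ (e (2 * i + r + 1)).r x y)
    (hm : m' = 2 * m + r) (hn : n' = 2 * n + r) (hm₁ : m₁' = 2 * m₁ + r)
    (hn₁ : n₁' = 2 * n₁ + r) :
    Arrow e' L m n m₁ n₁ U W ↔ Arrow e L m' n' m₁' n₁' U W := by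
  subst hm hn hm₁ hn₁
  exact exists_congr fun x => and_congr Iff.rfl (and_congr (reg_reindex h)
    (by rw [past_reindex h, past_reindex h]))

end

theorem isSync_reindex
    (h : ∀ i x y, (e' i).r x y ↔ (e (2 * i + r)).r x y ∧ (e (2 * i + r + 1)).r x y) :
    IsSync e' ↔ IsSync e := by
  constructor
  · intro hs m n N x hn
    -- All endpoints are rounded outwards to whole pairs. The minimum is needed because `Reg.left`
    -- can move the future back to `N` only if the past starts no later than `N`.
    obtain ⟨y, h1, h2⟩ := hs ((min m N - r) / 2 - 1) ((n - r) / 2 - 1) ((N - r) / 2 + 1) x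
      (by omega)
    refine ⟨y, ((seg_reindex h).1 h1).mono (by omega) (by omega), ?_⟩
    have h3 : Reg e (min m N) (2 * ((N - r) / 2 + 1) + r) y := ((reg_reindex h).1 h2).mono (by omega)
    exact (h3.left (min_le_right _ _) (by omega)).mono (min_le_left _ _)
  · intro hs m n N x hn
    obtain ⟨y, h1, h2⟩ := hs (2 * m + r) (2 * n + r) (2 * N + r) x (by omega)
    exact ⟨y, (seg_reindex h).2 h1, (reg_reindex h).2 h2⟩

end Reindex

/-! ### The symbolic matrix system of a partition -/

section PastSystem

variable {Z : Type u} (T : Equiv.Perm Z)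

/-- The observables that tell the `s`-class of `T ^ i x`. -/
def orbit (s : Setoid Z) (i : ℤ) : Setoid Z := s.comap ⇑(T ^ i)

theorem orbit_add_one (s : Setoid Z) (i : ℤ) (x y : Z) :
    (orbit T s (i + 1)).r x y ↔ (orbit T s i).r (T x) (T y) := by
  change s.r _ _ ↔ s.r _ _
  rw [zpow_add_one]
  rfl

/-- The vertices of level `l`: the pasts of length `l` of the regular points. -/
def PastVertex (s : Setoid Z) (l : ℕ) : Type u :=
  {S : Set Z // IsVertex (orbit T s) (-l) 0 S}

/-- A past is saturated under agreement on `l` observables, so it is determined by the set of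
`l`-words that its points show. -/
theorem PastVertex.finite (s : Setoid Z) [Finite (Quotient s)] (l : ℕ) :
    Finite (PastVertex T s l) := by
  refine Finite.of_injective (β := Set (Fin l → Quotient s)) (fun S => {b | ∃ z ∈ S.1,
    ∀ k : Fin l, (⟦(T ^ (-(l : ℤ) + k)) z⟧ : Quotient s) = b k}) ?_
  have key : ∀ S S' : PastVertex T s l, {b : Fin l → Quotient s | ∃ z ∈ S.1,
      ∀ k : Fin l, (⟦(T ^ (-(l : ℤ) + k)) z⟧ : Quotient s) = b k} ⊆ {b | ∃ z ∈ S'.1,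
      ∀ k : Fin l, (⟦(T ^ (-(l : ℤ) + k)) z⟧ : Quotient s) = b k} → S.1 ⊆ S'.1 := by
    rintro S ⟨_, x, hx, rfl⟩ h z hz
    obtain ⟨y, ⟨w, hw1, hw2⟩, hy⟩ := h ⟨z, hz, fun k => rfl⟩
    refine ⟨w, hw1, hw2.trans fun i h1 h2 => ?_⟩
    have := Quotient.exact (hy ⟨(i + l).toNat, by omega⟩)
    simp only [show -(l : ℤ) + ((i + l).toNat : ℤ) = i by omega] at this
    exact this
  intro S S' h
  exact Subtype.ext ((key S S' h.subset).antisymm (key S' S h.superset))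

/-- The map from pasts of length `l + 1` to pasts of length `l`. -/
def PastVertex.iota (s : Setoid Z) (l : ℕ) (w : PastVertex T s (l + 1)) : PastVertex T s l :=
  ⟨sat (orbit T s) (-l) 0 w.1, w.2.sat (by push_cast; omega)⟩

/-- The edges from level `l` to level `l + 1`. -/
def PastEdge (s : Setoid Z) (l : ℕ) (u : PastVertex T s l) (a : Quotient s)
    (w : PastVertex T s (l + 1)) : Prop :=
  Arrow (orbit T s) {x | (⟦x⟧ : Quotient s) = a} (-l) 0 (-l) 1 u.1 (T ⁻¹' w.1)

variable {T} {s : Setoid Z}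

theorem mk_eq_of_seg {a : Quotient s} : ∀ x ∈ {x | (⟦x⟧ : Quotient s) = a}, ∀ y,
    Seg (orbit T s) 0 1 x y → y ∈ {x | (⟦x⟧ : Quotient s) = a} := by
  rintro x rfl y hxy
  exact (Quotient.sound (hxy 0 le_rfl one_pos)).symm

theorem PastEdge.resolving {l : ℕ} {a : Quotient s} {w : PastVertex T s (l + 1)}
    {u u' : PastVertex T s l} (h : PastEdge T s l u a w) (h' : PastEdge T s l u' a w) :
    u = u' := by
  refine Subtype.ext (Arrow.left_unique h h' ?_ le_rfl (by omega) (by omega))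
  intro x hx y hy i h1 h2
  obtain rfl : i = 0 := by omega
  exact Quotient.exact (hx.trans hy.symm)

/-- Both sides of `I M = M I` describe the same arrows, from `[-l, 0)` to `[-(l+1), 1)`. The past
`w` lives on `[-(l+2), 0)`, and the preimage under `T` moves it one index to the right. -/
theorem exists_iota_pastEdge_iff {l : ℕ} {u : PastVertex T s l} {a : Quotient s}
    {w : PastVertex T s (l + 2)} :
    (∃ v, PastVertex.iota T s l v = u ∧ PastEdge T s (l + 1) v a w) ↔
      Arrow (orbit T s) {x | (⟦x⟧ : Quotient s) = a} (-l) 0 (-(l + 1 : ℕ)) 1 u.1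
        (T ⁻¹' w.1) := by
  rw [← exists_sat_arrow_iff (m₁ := -(l + 1 : ℕ)) le_rfl (by omega) (by omega) (by omega)]
  constructor
  · rintro ⟨v, rfl, hv⟩
    exact ⟨v.1, v.2, rfl, hv⟩
  · rintro ⟨V, hV, h, hv⟩
    exact ⟨⟨V, hV⟩, Subtype.ext h, hv⟩

theorem pastEdge_iota_iff {l : ℕ} {u : PastVertex T s l} {a : Quotient s}
    {w : PastVertex T s (l + 2)} :
    PastEdge T s l u a (PastVertex.iota T s (l + 1) w) ↔
      Arrow (orbit T s) {x | (⟦x⟧ : Quotient s) = a} (-l) 0 (-(l + 1 : ℕ)) 1 u.1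
        (T ⁻¹' w.1) := by
  unfold PastEdge PastVertex.iota
  rw [← sat_shift (orbit_add_one T s) (m₁ := -l) (n₁ := 1) (by push_cast; ring) (by ring)]
  refine arrow_target_sat_iff (by omega) ?_ le_rfl (by omega) (by omega) mk_eq_of_seg
  exact (isVertex_shift_iff (orbit_add_one T s) (by push_cast; ring) (by ring)).2 w.2

variable (T s)

/-- The symbolic matrix system of the pasts of regular points with respect to a finite partition
into `s`-classes. -/
noncomputable def pastSystem [Finite (Quotient s)] (hs : IsSync (orbit T s)) :
    SymbolicMatrixSystem.{u} :=
  haveI := PastVertex.finite T s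
  letI := fun l => Fintype.ofFinite (PastVertex T s l)
  { Alphabet := Quotient s
    Index := PastVertex T s
    M := fun l => relMatrix (PastEdge T s l)
    I := fun l => mapMatrix (PastVertex.iota T s l)
    I_zero_or_one := fun l i j => by
      unfold mapMatrix
      split_ifs <;> simp
    I_row := fun l i => by
      obtain ⟨V, hV, h⟩ := hs.exists_sat_eq (m' := -((l + 1 : ℕ) : ℤ)) i.2
        (by push_cast; omega) (by omega)
      exact ⟨⟨V, hV⟩, if_pos (Subtype.ext h)⟩
    I_col := fun l j => by
      refine ⟨PastVertex.iota T s l j, if_pos rfl, fun i hi => ?_⟩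
      by_contra h
      exact zero_ne_one ((if_neg (Ne.symm h)).symm.trans hi)
    comm := fun l => by
      rw [natMulSym_relMatrix _ fun _ _ _ _ => PastEdge.resolving, symMulNat_relMatrix]
      funext u w
      exact labels_congr fun a => exists_iota_pastEdge_iff.trans pastEdge_iota_iff.symm }

theorem pastSystem_isPresentedBy [Finite (Quotient s)] (hs : IsSync (orbit T s)) :
    (pastSystem T s hs).IsPresentedBy (PastEdge T s) (PastVertex.iota T s) where
  M_eq _ := rfl
  I_eq _ := rfl
  resolving _ _ _ _ _ := PastEdge.resolving

end PastSystem

/-! ### Bipartite steps -/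

section Bipartite

variable {Z : Type u} (T : Equiv.Perm Z) (c d : Setoid Z)

/-- The observables `…, c x, d x, c (T x), d (T x), …`. -/
def interleave (k : ℤ) : Setoid Z :=
  if k % 2 = 0 then c.comap ⇑(T ^ (k / 2)) else d.comap ⇑(T ^ (k / 2))

theorem interleave_two_mul (i : ℤ) : interleave T c d (2 * i) = c.comap ⇑(T ^ i) := by
  unfold interleave
  rw [if_pos (by omega), show 2 * i / 2 = i by omega]

theorem interleave_two_mul_add_one (i : ℤ) :
    interleave T c d (2 * i + 1) = d.comap ⇑(T ^ i) := by
  unfold interleave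
  rw [if_neg (by omega), show (2 * i + 1) / 2 = i by omega]

theorem orbit_inf_iff (i : ℤ) (x y : Z) : (orbit T (c ⊓ d) i).r x y ↔
    (interleave T c d (2 * i + 0)).r x y ∧ (interleave T c d (2 * i + 0 + 1)).r x y := by
  rw [add_zero, interleave_two_mul, interleave_two_mul_add_one]
  rfl

theorem orbit_inf_comap_iff (i : ℤ) (x y : Z) : (orbit T (d ⊓ c.comap T) i).r x y ↔
    (interleave T c d (2 * i + 1)).r x y ∧ (interleave T c d (2 * i + 1 + 1)).r x y := by
  rw [interleave_two_mul_add_one, show 2 * i + 1 + 1 = 2 * (1 + i) by ring, interleave_two_mul,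
    zpow_add, zpow_one]
  rfl

theorem interleave_add_two (i : ℤ) (x y : Z) : (interleave T c d (i + 2)).r x y ↔
    (interleave T c d i).r (T x) (T y) := by
  rcases Int.even_or_odd' i with ⟨k, rfl | rfl⟩
  · rw [show 2 * k + 2 = 2 * (k + 1) by ring, interleave_two_mul, interleave_two_mul,
      zpow_add_one]
    rfl
  · rw [show 2 * k + 1 + 2 = 2 * (k + 1) + 1 by ring, interleave_two_mul_add_one,
      interleave_two_mul_add_one, zpow_add_one]
    rfl

theorem isSync_bipartite : IsSync (orbit T (c ⊓ d)) ↔ IsSync (orbit T (d ⊓ c.comap T)) :=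
  (isSync_reindex (orbit_inf_iff T c d)).trans (isSync_reindex (orbit_inf_comap_iff T c d)).symm

theorem Setoid.finite_quotient_of_le {s t : Setoid Z} (h : s ≤ t) [Finite (Quotient s)] :
    Finite (Quotient t) :=
  Finite.of_surjective (Quotient.map' id h : Quotient s → Quotient t)
    fun q => Quotient.inductionOn' q fun x => ⟨Quotient.mk'' x, rfl⟩

/-- The pair of classes determined by the common class. -/
def quotientInf (c d : Setoid Z) : Quotient (c ⊓ d) → Quotient c × Quotient d :=
  Quotient.lift (fun x => (⟦x⟧, ⟦x⟧)) fun _ _ h =>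
    Prod.ext (Quotient.sound h.1) (Quotient.sound h.2)

theorem quotientInf_injective (c d : Setoid Z) : Function.Injective (quotientInf c d) := by
  rintro ⟨x⟩ ⟨y⟩ h
  exact Quotient.sound ⟨Quotient.exact (congrArg Prod.fst h), Quotient.exact (congrArg Prod.snd h)⟩

/-- The pair of classes at `x` and at `T x` determined by the common class. -/
def quotientInfComap : Quotient (d ⊓ c.comap T) → Quotient d × Quotient c :=
  Quotient.lift (fun x => (⟦x⟧, ⟦T x⟧)) fun _ _ h =>
    Prod.ext (Quotient.sound h.1) (Quotient.sound h.2)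

theorem quotientInfComap_injective : Function.Injective (quotientInfComap T c d) := by
  rintro ⟨x⟩ ⟨y⟩ h
  have h2 : c.r (T x) (T y) := Quotient.exact (congrArg Prod.snd h)
  exact Quotient.sound ⟨Quotient.exact (congrArg Prod.fst h), h2⟩

variable {T c d}

theorem mem_of_seg_even {γ : Quotient c} (k : ℤ) {n n' : ℤ} (hn : n = 2 * k) (hn' : n < n') :
    ∀ x ∈ {x | (⟦(T ^ k) x⟧ : Quotient c) = γ}, ∀ y, Seg (interleave T c d) n n' x y →
      y ∈ {x | (⟦(T ^ k) x⟧ : Quotient c) = γ} := by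
  rintro x rfl y hxy
  have := hxy n le_rfl hn'
  rw [hn, interleave_two_mul] at this
  exact (Quotient.sound (s := c) (a := (T ^ k) x) (b := (T ^ k) y) this).symm

theorem mem_of_seg_odd {δ : Quotient d} {n' : ℤ} (hn' : 1 < n') :
    ∀ x ∈ {x | (⟦x⟧ : Quotient d) = δ}, ∀ y, Seg (interleave T c d) 1 n' x y →
      y ∈ {x | (⟦x⟧ : Quotient d) = δ} := by
  rintro x rfl y hxy
  have := hxy (2 * 0 + 1) le_rfl (by omega)
  rw [interleave_two_mul_add_one] at this
  exact (Quotient.sound this).symm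

variable (T c d)

/-- Everything is transported to the interleaved sequence, where an edge of either system advances
by two indices and an edge of `H` or `K` by one. -/
theorem strongShiftEquivalentOneStep_bipartite [Finite (Quotient (c ⊓ d))]
    [Finite (Quotient (d ⊓ c.comap T))] (hs : IsSync (orbit T (c ⊓ d)))
    (ht : IsSync (orbit T (d ⊓ c.comap T))) :
    StrongShiftEquivalentOneStep (pastSystem T (c ⊓ d) hs)
      (pastSystem T (d ⊓ c.comap T) ht) := by
  have hc := Setoid.finite_quotient_of_le (inf_le_left : c ⊓ d ≤ c)
  have hd := Setoid.finite_quotient_of_le (inf_le_right : c ⊓ d ≤ d)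
  have hs2 := orbit_inf_iff T c d
  have ht2 := orbit_inf_comap_iff T c d
  have hT := interleave_add_two T c d
  let e := interleave T c d
  -- With offset 1, level `l + 1` occupies `[-2(l+1)+1, 1) = [-2l-1, 1)`.
  let H (l : ℕ) (u : PastVertex T (c ⊓ d) l) (γ : Quotient c)
    (w : PastVertex T (d ⊓ c.comap T) (l + 1)) : Prop :=
    Arrow e {x | (⟦x⟧ : Quotient c) = γ} (-2 * l) 0 (-2 * l - 1) 1 u.1 w.1
  -- With offset 0, level `l + 1` occupies `[-2l-2, 0)`; one application of `T` moves it to `[-2l,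
  -- 2)`.
  let K (l : ℕ) (u : PastVertex T (d ⊓ c.comap T) l) (δ : Quotient d)
    (w : PastVertex T (c ⊓ d) (l + 1)) : Prop :=
    Arrow e {x | (⟦x⟧ : Quotient d) = δ} (-2 * l + 1) 1 (-2 * l) 2 u.1 (T ⁻¹' w.1)
  have hHc : ∀ {γ : Quotient c}, ∀ x ∈ {x | (⟦x⟧ : Quotient c) = γ}, ∀ y, Seg e 0 1 x y →
      y ∈ {x | (⟦x⟧ : Quotient c) = γ} := mem_of_seg_even 0 rfl (by omega)
  have hHd : ∀ {δ : Quotient d}, ∀ x ∈ {x | (⟦x⟧ : Quotient d) = δ}, ∀ y, Seg e 1 2 x y →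
      y ∈ {x | (⟦x⟧ : Quotient d) = δ} := mem_of_seg_odd (by omega)
  have hHc' : ∀ {γ : Quotient c}, ∀ x ∈ T ⁻¹' {x | (⟦x⟧ : Quotient c) = γ}, ∀ y,
      Seg e 2 3 x y → y ∈ T ⁻¹' {x | (⟦x⟧ : Quotient c) = γ} :=
    mem_of_seg_even 1 rfl (by omega)
  refine strongShiftEquivalentOneStep_of_relations
    (pastSystem_isPresentedBy T (c ⊓ d) hs) (pastSystem_isPresentedBy T (d ⊓ c.comap T) ht)
    (quotientInf_injective c d) (quotientInfComap_injective T c d) H K ?_ ?_ ?_ ?_ ?_ ?_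
  · intro l γ w u u' h h'
    refine Subtype.ext (Arrow.left_unique h h' ?_ (by omega) (by omega) (by omega))
    intro x hx y hy i h1 h2
    obtain rfl : i = 2 * 0 := by omega
    change (interleave T c d (2 * 0)).r x y
    rw [interleave_two_mul]
    exact Quotient.exact (hx.trans hy.symm)
  · intro l γ w u u' h h'
    refine Subtype.ext (Arrow.left_unique h h' ?_ (by omega) (by omega) (by omega))
    intro x hx y hy i h1 h2
    obtain rfl : i = 2 * 0 + 1 := by omega
    change (interleave T c d (2 * 0 + 1)).r x y
    rw [interleave_two_mul_add_one]
    exact Quotient.exact (hx.trans hy.symm)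
  -- Arrows from `[-2l, 0)` to `[-2l-2, 2)`, cut at `[-2l-1, 1)`.
  · intro l (u : PastVertex T (c ⊓ d) l) γ δ (w : PastVertex T (c ⊓ d) (l + 2))
    have h1 : (∃ a, (∃ v, PastVertex.iota T (c ⊓ d) l v = u ∧
        PastEdge T (c ⊓ d) (l + 1) v a w) ∧ quotientInf c d a = (γ, δ)) ↔
        Arrow e ({x | (⟦x⟧ : Quotient c) = γ} ∩ {x | (⟦x⟧ : Quotient d) = δ}) (-2 * l) 0
          (-2 * l - 2) 2 u.1 (T ⁻¹' w.1) := by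
      simp only [exists_iota_pastEdge_iff]
      rw [exists_arrow_iff, arrow_reindex hs2 (m' := -2 * l) (n' := 0) (m₁' := -2 * l - 2)
        (n₁' := 2) (by ring) rfl (by push_cast; ring) rfl]
      simp only [quotientInf, Quotient.lift_mk, Prod.mk.injEq]
      rfl
    refine h1.trans (Iff.trans (arrow_comp (m₁ := -2 * l - 1) (n₁ := 1) (by omega) (by omega)
      (by omega) (by omega) (by omega) hHc hHd).symm ?_)
    constructor
    · rintro ⟨V, hV, h2, h3⟩
      refine ⟨⟨V, (isVertex_reindex ht2 (by push_cast; ring) rfl).2 hV⟩, h2, ?_⟩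
      convert h3 using 1 <;> push_cast <;> ring
    · rintro ⟨V, h2, h3⟩
      refine ⟨V.1, (isVertex_reindex ht2 (by push_cast; ring) rfl).1 V.2, h2, ?_⟩
      convert h3 using 1 <;> push_cast <;> ring
  -- Arrows from `[-2l+1, 1)` to `[-2l-1, 3)`, cut at `[-2l, 2)`; the second half is `H` translated
  -- by `T`, that is, by two indices.
  · intro l (u : PastVertex T (d ⊓ c.comap T) l) δ γ (w : PastVertex T (d ⊓ c.comap T) (l + 2))
    have h1 : (∃ a, (∃ v, PastVertex.iota T (d ⊓ c.comap T) l v = u ∧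
        PastEdge T (d ⊓ c.comap T) (l + 1) v a w) ∧ quotientInfComap T c d a = (δ, γ)) ↔
        Arrow e ({x | (⟦x⟧ : Quotient d) = δ} ∩ T ⁻¹' {x | (⟦x⟧ : Quotient c) = γ})
          (-2 * l + 1) 1 (-2 * l - 1) 3 u.1 (T ⁻¹' w.1) := by
      simp only [exists_iota_pastEdge_iff]
      rw [exists_arrow_iff, arrow_reindex ht2 (m' := -2 * l + 1) (n' := 1) (m₁' := -2 * l - 1)
        (n₁' := 3) (by ring) rfl (by push_cast; ring) rfl]
      simp only [quotientInfComap, Quotient.lift_mk, Prod.mk.injEq]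
      rfl
    refine h1.trans (Iff.trans (arrow_comp (m₁ := -2 * l) (n₁ := 2) (by omega) (by omega)
      (by omega) (by omega) (by omega) hHd hHc').symm ?_)
    have hsh : ∀ V, IsVertex e (-2 * l) 2 (T ⁻¹' V) ↔
        IsVertex (orbit T (c ⊓ d)) (-(l + 1 : ℕ)) 0 V := fun V =>
      (isVertex_shift_iff hT (by ring) (by ring)).trans
        (isVertex_reindex hs2 (m' := -2 * l - 2) (n' := 0) (by push_cast; ring) rfl).symm
    have hsa : ∀ V : PastVertex T (c ⊓ d) (l + 1), Arrow e (T ⁻¹' {x | (⟦x⟧ : Quotient c) = γ})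
        (-2 * l) 2 (-2 * l - 1) 3 (T ⁻¹' V.1) (T ⁻¹' w.1) ↔ H (l + 1) V γ w := fun V =>
      arrow_shift_iff hT (by push_cast; ring) (by ring) (by push_cast; ring) (by ring)
    constructor
    · rintro ⟨V, hV, h2, h3⟩
      rw [← T.preimage_symm_preimage V] at hV h2 h3
      exact ⟨⟨T.symm ⁻¹' V, (hsh _).1 hV⟩, h2, (hsa _).1 h3⟩
    · rintro ⟨V, h2, h3⟩
      exact ⟨T ⁻¹' V.1, (hsh _).2 V.2, h2, (hsa _).2 h3⟩
  -- Both sides are the arrows from `[-2l, 0)` to `[-2l-3, 1)`.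
  · intro l (u : PastVertex T (c ⊓ d) l) γ (w : PastVertex T (d ⊓ c.comap T) (l + 2))
    have hw := (isVertex_reindex ht2 (m' := -2 * l - 3) (n' := 1) (by push_cast; ring) rfl).1 w.2
    have h1 : H l u γ (PastVertex.iota T (d ⊓ c.comap T) (l + 1) w) ↔
        Arrow e {x | (⟦x⟧ : Quotient c) = γ} (-2 * l) 0 (-2 * l - 3) 1 u.1 w.1 := by
      change Arrow _ _ _ _ _ _ _ (sat _ _ _ _) ↔ _
      rw [sat_reindex ht2 (m' := -2 * l - 1) (n' := 1) (by push_cast; ring) rfl]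
      exact arrow_target_sat_iff (by omega) hw (by omega) (by omega) (by omega) hHc
    refine h1.trans (Iff.trans (exists_sat_arrow_iff (m₁ := -2 * l - 2) (by omega) (by omega)
      (by omega) (by omega)).symm ?_)
    have hH : ∀ V : PastVertex T (c ⊓ d) (l + 1), H (l + 1) V γ w ↔
        Arrow e {x | (⟦x⟧ : Quotient c) = γ} (-2 * l - 2) 0 (-2 * l - 3) 1 V.1 w.1 := fun V => by
      change Arrow _ _ _ _ _ _ _ _ ↔ _
      rw [show -2 * ((l + 1 : ℕ) : ℤ) = -2 * l - 2 by push_cast; ring,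
        show -2 * (l : ℤ) - 2 - 1 = -2 * l - 3 by ring]
    have hι : ∀ V : PastVertex T (c ⊓ d) (l + 1), PastVertex.iota T (c ⊓ d) l V = u ↔
        sat e (-2 * l) 0 V.1 = u.1 := fun V => Subtype.ext_iff.trans
      (iff_of_eq (congrArg (· = u.1) (sat_reindex hs2 (by ring) rfl)))
    constructor
    · rintro ⟨V, hV, h2, h3⟩
      let V' : PastVertex T (c ⊓ d) (l + 1) :=
        ⟨V, (isVertex_reindex hs2 (by push_cast; ring) rfl).2 hV⟩
      exact ⟨V', (hι V').2 h2, (hH V').2 h3⟩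
    · rintro ⟨V, h2, h3⟩
      exact ⟨V.1, (isVertex_reindex hs2 (by push_cast; ring) rfl).1 V.2, (hι V).1 h2,
        (hH V).1 h3⟩
  -- Both sides are the arrows from `[-2l+1, 1)` to `[-2l-2, 2)`.
  · intro l (u : PastVertex T (d ⊓ c.comap T) l) δ (w : PastVertex T (c ⊓ d) (l + 2))
    have hw := (isVertex_shift_iff hT (m₁ := -2 * l - 2) (n₁ := 2) (by ring) (by ring)).2
      ((isVertex_reindex hs2 (m' := -2 * l - 4) (n' := 0) (by push_cast; ring) rfl).1 w.2)
    have h1 : K l u δ (PastVertex.iota T (c ⊓ d) (l + 1) w) ↔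
        Arrow e {x | (⟦x⟧ : Quotient d) = δ} (-2 * l + 1) 1 (-2 * l - 2) 2 u.1 (T ⁻¹' w.1) := by
      change Arrow _ _ _ _ _ _ _ (T ⁻¹' (sat _ _ _ _)) ↔ _
      rw [sat_reindex hs2 (m' := -2 * l - 2) (n' := 0) (by push_cast; ring) rfl,
        ← sat_shift hT (m₁ := -2 * l) (n₁ := 2) (by ring) (by ring)]
      exact arrow_target_sat_iff (by omega) hw (by omega) (by omega) (by omega) hHd
    refine h1.trans (Iff.trans (exists_sat_arrow_iff (m₁ := -2 * l - 1) (by omega) (by omega)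
      (by omega) (by omega)).symm ?_)
    have hK : ∀ V : PastVertex T (d ⊓ c.comap T) (l + 1), K (l + 1) V δ w ↔
        Arrow e {x | (⟦x⟧ : Quotient d) = δ} (-2 * l - 1) 1 (-2 * l - 2) 2 V.1 (T ⁻¹' w.1) :=
      fun V => by
        change Arrow _ _ _ _ _ _ _ _ ↔ _
        rw [show -2 * ((l + 1 : ℕ) : ℤ) = -2 * l - 2 by push_cast; ring,
          show -2 * (l : ℤ) - 2 + 1 = -2 * l - 1 by ring]
    have hι : ∀ V : PastVertex T (d ⊓ c.comap T) (l + 1),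
        PastVertex.iota T (d ⊓ c.comap T) l V = u ↔ sat e (-2 * l + 1) 1 V.1 = u.1 := fun V =>
      Subtype.ext_iff.trans (iff_of_eq (congrArg (· = u.1) (sat_reindex ht2 (by ring) rfl)))
    constructor
    · rintro ⟨V, hV, h2, h3⟩
      let V' : PastVertex T (d ⊓ c.comap T) (l + 1) :=
        ⟨V, (isVertex_reindex ht2 (by push_cast; ring) rfl).2 hV⟩
      exact ⟨V', (hι V').2 h2, (hK V').2 h3⟩
    · rintro ⟨V, h2, h3⟩
      exact ⟨V.1, (isVertex_reindex ht2 (by push_cast; ring) rfl).1 V.2, (hι V).1 h2,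
        (hK V).1 h3⟩

end Bipartite

/-! ### Chains of bipartite steps -/

section Chain

variable {Z : Type u} (T : Equiv.Perm Z)

/-- One bipartite step between partitions. -/
def Bipartite (s t : Setoid Z) : Prop :=
  ∃ c d : Setoid Z, s = c ⊓ d ∧ t = d ⊓ c.comap T

/-- Partitions joined by a chain of bipartite steps in both directions. -/
def Linked : Setoid Z → Setoid Z → Prop := Relation.EqvGen (Bipartite T)

variable {T} {s t p q c d : Setoid Z}

theorem finite_quotient_inf [Finite (Quotient c)] [Finite (Quotient d)] :
    Finite (Quotient (c ⊓ d)) :=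
  Finite.of_injective _ (quotientInf_injective c d)

theorem finite_quotient_comap_iff :
    Finite (Quotient (c.comap T)) ↔ Finite (Quotient c) := by
  let f : Quotient (c.comap T) → Quotient c := Quotient.map' T fun _ _ h => h
  constructor
  · intro h
    refine Finite.of_surjective f fun q => ?_
    obtain ⟨x, rfl⟩ := Quotient.exists_rep q
    exact ⟨⟦T.symm x⟧, congrArg (fun y => (⟦y⟧ : Quotient c)) (T.apply_symm_apply x)⟩
  · intro h
    refine Finite.of_injective f ?_
    rintro ⟨x⟩ ⟨y⟩ h
    have h' : c.r (T x) (T y) := Quotient.exact h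
    exact Quotient.sound h'

/-- Finiteness and synchronization must pass along every link, in both directions, for the
intermediate partitions of a chain to have matrix systems at all. -/
theorem Bipartite.finite_iff (h : Bipartite T s t) :
    Finite (Quotient s) ↔ Finite (Quotient t) := by
  obtain ⟨c, d, rfl, rfl⟩ := h
  constructor
  · intro h
    have := Setoid.finite_quotient_of_le (inf_le_left : c ⊓ d ≤ c)
    have := Setoid.finite_quotient_of_le (inf_le_right : c ⊓ d ≤ d)
    have := (finite_quotient_comap_iff (T := T) (c := c)).2 inferInstance
    exact finite_quotient_inf
  · intro h
    have := Setoid.finite_quotient_of_le (inf_le_left : d ⊓ c.comap T ≤ d)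
    have := Setoid.finite_quotient_of_le (inf_le_right : d ⊓ c.comap T ≤ c.comap T)
    have := (finite_quotient_comap_iff (T := T) (c := c)).1 inferInstance
    exact finite_quotient_inf

theorem Bipartite.isSync_iff (h : Bipartite T s t) : IsSync (orbit T s) ↔ IsSync (orbit T t) := by
  obtain ⟨c, d, rfl, rfl⟩ := h
  exact isSync_bipartite T c d

theorem Bipartite.oneStep (h : Bipartite T s t) [Finite (Quotient s)] [Finite (Quotient t)]
    (hs : IsSync (orbit T s)) (ht : IsSync (orbit T t)) :
    StrongShiftEquivalentOneStep (pastSystem T s hs) (pastSystem T t ht) := by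
  obtain ⟨c, d, rfl, rfl⟩ := h
  exact strongShiftEquivalentOneStep_bipartite T c d hs ht

theorem bipartite_comap : Bipartite T s (s.comap T) :=
  ⟨s, ⊤, inf_top_eq s |>.symm, top_inf_eq _ |>.symm⟩

theorem StrongShiftEquivalent.symm {S S' : SymbolicMatrixSystem.{u}}
    (h : StrongShiftEquivalent S S') : StrongShiftEquivalent S' S := by
  induction h with
  | single h => exact .single h.symm
  | tail _ h ih => exact .head h.symm ih

theorem Linked.finite_iff (h : Linked T s t) : Finite (Quotient s) ↔ Finite (Quotient t) := by
  induction h with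
  | rel _ _ h => exact h.finite_iff
  | refl => exact Iff.rfl
  | symm _ _ _ ih => exact ih.symm
  | trans _ _ _ _ _ ih ih' => exact ih.trans ih'

theorem Linked.isSync_iff (h : Linked T s t) : IsSync (orbit T s) ↔ IsSync (orbit T t) := by
  induction h with
  | rel _ _ h => exact h.isSync_iff
  | refl => exact Iff.rfl
  | symm _ _ _ ih => exact ih.symm
  | trans _ _ _ _ _ ih ih' => exact ih.trans ih'

theorem Linked.strongShiftEquivalent (h : Linked T s t) [Finite (Quotient s)]
    [Finite (Quotient t)] (hs : IsSync (orbit T s)) (ht : IsSync (orbit T t)) :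
    StrongShiftEquivalent (pastSystem T s hs) (pastSystem T t ht) := by
  rename_i h1 h2
  revert h1 h2 hs ht
  induction h with
  | rel _ _ h => exact fun hs ht => .single (h.oneStep hs ht)
  | refl s =>
    -- A chain has at least one link, so reflexivity is a round trip through `s.comap T`.
    intro _ _ hs _
    have := (finite_quotient_comap_iff (T := T) (c := s)).2 inferInstance
    have h := bipartite_comap.oneStep hs (bipartite_comap.isSync_iff.1 hs)
    exact .head h (.single h.symm)
  | symm _ _ _ ih => exact fun hs ht => (ih ht hs).symm
  | trans _ _ _ h h' ih ih' =>
    intro _ _ hs ht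
    have := (Linked.finite_iff h).1 inferInstance
    exact (ih hs ((Linked.isSync_iff h).1 hs)).trans (ih' _ ht)

theorem Linked.symm (h : Linked T s t) : Linked T t s := Relation.EqvGen.symm _ _ h

theorem Linked.trans (h : Linked T s t) (h' : Linked T t p) : Linked T s p :=
  Relation.EqvGen.trans _ _ _ h h'

/-! ### Refinements of partitions as chains of bipartite steps -/

theorem bipartite_inf_comap : Bipartite T p (p ⊓ p.comap T) := ⟨p, p, inf_idem p |>.symm, rfl⟩

/-- Both partitions have a bipartite step to `p ⊓ p.comap T`: split `p` as `p ⊓ p` and `q` as `p ⊓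
q`. In `Linked.of_le_comap` the factors of `q` are exchanged. -/
theorem Linked.of_le (h : q ≤ p) (h' : p ⊓ p.comap T ≤ q) : Linked T p q := by
  refine (Relation.EqvGen.rel _ _ bipartite_inf_comap).trans _ _ _
    (Relation.EqvGen.symm _ _ (.rel _ _ ⟨p, q, ?_, ?_⟩))
  · exact (inf_eq_right.2 h).symm
  · exact le_antisymm (le_inf h' inf_le_right) (inf_le_inf_right _ h)

theorem Linked.of_le_comap (h : q ≤ p) (h' : p ⊓ p.comap T ≤ q.comap T) : Linked T p q := by
  refine (Relation.EqvGen.rel _ _ bipartite_inf_comap).trans _ _ _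
    (Relation.EqvGen.symm _ _ (.rel _ _ ⟨q, p, ?_, ?_⟩))
  · exact (inf_eq_left.2 h).symm
  · exact le_antisymm (le_inf inf_le_left h') (inf_le_inf_left _ fun x y hxy => h hxy)

/-- The refinement of a partition by one step into the past and one into the future. -/
def widen (T : Equiv.Perm Z) (t : Setoid Z) : Setoid Z :=
  (t ⊓ t.comap T) ⊓ (t ⊓ t.comap T).comap T.symm

theorem widen_le : widen T t ≤ t := inf_le_left.trans inf_le_left

theorem widen_mono (h : s ≤ t) : widen T s ≤ widen T t :=
  fun _ _ hxy => ⟨⟨h hxy.1.1, h hxy.1.2⟩, h hxy.2.1, h hxy.2.2⟩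

/-- The future symbol is added by `Linked.of_le`, then the past ones by `Linked.of_le_comap`; the
factor `s` is carried along. -/
theorem linked_inf_widen : Linked T (s ⊓ t) (s ⊓ widen T t) := by
  have h1 : Linked T (s ⊓ t) (s ⊓ (t ⊓ t.comap T)) := by
    refine Linked.of_le (inf_le_inf_left _ inf_le_left) fun x y hxy => ?_
    exact ⟨hxy.1.1, hxy.1.2, hxy.2.2⟩
  refine h1.trans (Linked.of_le_comap (inf_le_inf_left _ inf_le_left) fun x y hxy => ?_)
  refine ⟨hxy.2.1, hxy.2.2, ?_⟩
  change (t ⊓ t.comap T).r (T.symm (T x)) (T.symm (T y))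
  rw [T.symm_apply_apply, T.symm_apply_apply]
  exact hxy.1.2

theorem linked_inf_iterate_widen (h : s ≤ t) (k : ℕ) :
    Linked T s (s ⊓ (widen T)^[k] t) := by
  induction k with
  | zero => exact (inf_eq_left.2 h).symm ▸ Relation.EqvGen.refl _
  | succ k ih =>
    rw [Function.iterate_succ_apply']
    exact ih.trans linked_inf_widen

theorem iterate_widen_le (k : ℕ) : (widen T)^[k] s ≤ s := by
  induction k with
  | zero => exact le_rfl
  | succ k ih =>
    rw [Function.iterate_succ_apply']
    exact widen_le.trans ih

theorem linked_iterate_widen (k : ℕ) : Linked T s ((widen T)^[k] s) := by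
  have := linked_inf_iterate_widen (T := T) (le_refl s) k
  rwa [inf_eq_right.2 (iterate_widen_le k)] at this

/-- Widening `t` by `n + k` steps brings it below the `n`-fold widening of `s`, which is itself
below `t`. So meeting the latter with the widened `t` gives just the widened `t`. -/
theorem linked_of_iterate_widen_le {n k : ℕ} (h : (widen T)^[n] s ≤ t)
    (h' : (widen T)^[k] t ≤ s) : Linked T s t := by
  have h1 := linked_inf_iterate_widen (T := T) h (n + k)
  have h2 : (widen T)^[n + k] t ≤ (widen T)^[n] s := by
    rw [Function.iterate_add_apply]
    exact Monotone.iterate (fun _ _ => widen_mono) n h'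
  rw [inf_eq_right.2 h2] at h1
  exact ((linked_iterate_widen n).trans h1).trans (linked_iterate_widen _).symm

theorem iterate_widen_apply {k : ℕ} {x y : Z} (h : ((widen T)^[k] s).r x y) (i : ℤ)
    (hi : -k ≤ i) (hi' : i ≤ k) : s.r ((T ^ i) x) ((T ^ i) y) := by
  induction k generalizing x y i with
  | zero =>
    obtain rfl : i = 0 := by push_cast at hi hi'; omega
    exact h
  | succ k ih =>
    rw [Function.iterate_succ_apply'] at h
    push_cast at hi hi'
    rcases lt_trichotomy i 0 with h0 | rfl | h0
    · have := ih h.2.1 (i + 1) (by omega) (by omega)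
      rw [zpow_add_one] at this
      simpa using this
    · exact ih h.1.1 0 (by omega) (by omega)
    · have := ih h.1.2 (i - 1) (by omega) (by omega)
      rw [zpow_sub_one] at this
      simpa using this

end Chain

/-! ### The `λ`-synchronizing system through relations -/

section Frozen

variable {A : Type u} [TopologicalSpace A] {X : Subshift A ℤ}

theorem IsEdge.resolving {l : ℕ} {α : A} {w : Vertex X (l + 1)} {u u' : Vertex X l}
    (h : IsEdge X l u α w) (h' : IsEdge X l u' α w) : u = u' := by
  obtain ⟨ν, rfl⟩ := w.exists_mk
  obtain ⟨_, rfl⟩ := isEdge_mk_iff.1 h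
  obtain ⟨_, rfl⟩ := isEdge_mk_iff.1 h'
  rfl

theorem isEdge_iota_iff {l : ℕ} {u : Vertex X l} {α : A} {w : Vertex X (l + 2)} :
    IsEdge X l u α (Vertex.iota X (l + 1) w) ↔
      ∃ v, Vertex.iota X l v = u ∧ IsEdge X (l + 1) v α w := by
  obtain ⟨ν, rfl⟩ := w.exists_mk
  rw [Vertex.iota_mk, isEdge_mk_iff]
  constructor
  · rintro ⟨h, rfl⟩
    exact ⟨Vertex.mk X (l + 1) ⟨α :: ν.1, cons_mem_syncWords ν.2 h⟩, rfl,
      isEdge_mk_iff.2 ⟨h, rfl⟩⟩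
  · rintro ⟨v, rfl, hv⟩
    obtain ⟨h, rfl⟩ := isEdge_mk_iff.1 hv
    exact ⟨h, rfl⟩

open Classical in
-- An edge is a triple of source, label and target, so no label is repeated in an entry.
theorem sum_edge_eq_labels [Finite A] (l : ℕ) [Fintype (Edge X l)] (u : Vertex X l)
    (w : Vertex X (l + 1)) :
    (∑ e : Edge X l, if e.1.1 = u ∧ e.1.2.2 = w then ({e.1.2.1} : Multiset A) else 0) =
      labels fun α => IsEdge X l u α w := by
  refine eq_labels_iff.2 fun α => ?_
  rw [Multiset.count_sum']
  have h2 : ∀ e : Edge X l, Multiset.count α (if e.1.1 = u ∧ e.1.2.2 = w then {e.1.2.1} else 0) =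
      if (e.1.1 = u ∧ e.1.2.2 = w) ∧ e.1.2.1 = α then 1 else 0 := by
    intro e
    by_cases h : e.1.1 = u ∧ e.1.2.2 = w
    · rw [if_pos h, Multiset.count_singleton]
      by_cases h' : e.1.2.1 = α
      · rw [if_pos h'.symm, if_pos ⟨h, h'⟩]
      · rw [if_neg (Ne.symm h'), if_neg fun h'' => h' h''.2]
    · rw [if_neg h, if_neg fun h' => h h'.1, Multiset.count_zero]
  refine (Finset.sum_congr rfl fun e _ => h2 e).trans ((sum_ite_of_unique
    (fun e : Edge X l => (e.1.1 = u ∧ e.1.2.2 = w) ∧ e.1.2.1 = α)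
    (_x := inferInstance) ?_).trans ?_)
  rotate_left
  · refine if_congr ?_ rfl rfl
    constructor
    · rintro ⟨⟨⟨_, _, _⟩, he⟩, ⟨rfl, rfl⟩, rfl⟩
      exact he
    · exact fun h => ⟨⟨(u, α, w), h⟩, ⟨rfl, rfl⟩, rfl⟩
  · rintro ⟨⟨_, _, _⟩, he⟩ ⟨⟨_, _, _⟩, he'⟩ ⟨⟨rfl, rfl⟩, rfl⟩ ⟨⟨h3, h4⟩, h5⟩
    simp only at h3 h4 h5
    subst h3 h4 h5
    rfl

theorem lambdaGraphSystem_isPresentedBy [Finite A] (hX : IsLambdaSynchronizing X) :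
    (lambdaGraphSystem X hX).toSymbolicMatrixSystem.IsPresentedBy (IsEdge X)
      (Vertex.iota X) where
  M_eq l := by
    have := Edge.finite (X := X) l
    let _ := Fintype.ofFinite (Edge X l)
    funext u w
    exact sum_edge_eq_labels l u w
  I_eq l := rfl
  resolving _ _ _ _ _ := IsEdge.resolving

end Frozen

/-! ### Words and points -/

section Coding

variable {A : Type u} {Z : Type u} (T : Equiv.Perm Z) (a : Z → A)

/-- The word that `z` shows at the positions `m, …, m + n - 1`. -/
def word (z : Z) (m : ℤ) (n : ℕ) : List A := List.ofFn fun k : Fin n => a ((T ^ (m + k)) z)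

variable {T a}

@[simp]
theorem length_word (z : Z) (m : ℤ) (n : ℕ) : (word T a z m n).length = n := by simp [word]

theorem word_add (z : Z) (m : ℤ) (n k : ℕ) :
    word T a z m (n + k) = word T a z m n ++ word T a z (m + n) k := by
  unfold word
  rw [List.ofFn_add]
  simp [add_assoc]

theorem word_zpow (z : Z) (i m : ℤ) (n : ℕ) :
    word T a ((T ^ i) z) m n = word T a z (m + i) n := by
  unfold word
  congr 1
  funext k
  rw [← Equiv.Perm.mul_apply, ← zpow_add]
  congr 3
  ring

theorem word_succ (z : Z) (n : ℕ) : word T a z 0 (n + 1) = a z :: word T a (T z) 0 n := by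
  have h1 : word T a z 0 1 = [a z] := by simp [word]
  have h2 := word_zpow (T := T) (a := a) z 1 0 n
  rw [zpow_one] at h2
  rw [add_comm n 1, word_add, h1, h2]
  simp

theorem word_eq_word_iff {x y : Z} {m : ℤ} {n : ℕ} : word T a x m n = word T a y m n ↔
    Seg (orbit T (Setoid.ker a)) m (m + n) x y := by
  unfold word
  rw [List.ofFn_inj]
  constructor
  · intro h i h1 h2
    have := congrFun h ⟨(i - m).toNat, by omega⟩
    simp only [show m + ((i - m).toNat : ℤ) = i by omega] at this
    exact this
  · intro h
    funext k
    exact h (m + k) (by omega) (by omega)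

/-! ### Subshifts as sets of itineraries: synchronizing words and regular points -/

variable [TopologicalSpace A] {X : Subshift A ℤ}

/-- `X` is the set of the itineraries of the points of `Z`. -/
def Codes (T : Equiv.Perm Z) (a : Z → A) (X : Subshift A ℤ) : Prop :=
  ∀ p, p ∈ X.carrier ↔ ∃ z, ∀ i : ℤ, p i = a ((T ^ i) z)

theorem Codes.word_mem (hX : Codes T a X) (z : Z) (m : ℤ) (n : ℕ) :
    word T a z m n ∈ language X := by
  refine ⟨fun i => a ((T ^ i) z), (hX _).2 ⟨z, fun i => rfl⟩, m, fun k => ?_⟩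
  exact (List.get_ofFn (fun k : Fin n => a ((T ^ (m + k)) z)) k).symm

theorem Codes.exists_word_eq (hX : Codes T a X) {v : List A} (hv : v ∈ language X) (m : ℤ) :
    ∃ z, word T a z m v.length = v := by
  obtain ⟨p, hp, i, hi⟩ := hv
  obtain ⟨z, hz⟩ := (hX p).1 hp
  refine ⟨(T ^ (i - m)) z, ?_⟩
  rw [word_zpow, add_sub_cancel]
  refine List.ext_get (by simp) fun k h1 h2 => ?_
  rw [← hi ⟨k, h2⟩, hz]
  simp [word]

theorem Codes.exists_word_append_eq (hX : Codes T a X) {b v : List A}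
    (h : b ++ v ∈ language X) :
    ∃ z, word T a z (-b.length) b.length = b ∧ word T a z 0 v.length = v := by
  obtain ⟨z, hz⟩ := hX.exists_word_eq h (-b.length)
  rw [List.length_append, word_add, neg_add_cancel] at hz
  exact ⟨z, List.append_inj hz (length_word _ _ _)⟩

theorem Codes.append_word_mem (hX : Codes T a X) (z : Z) (l n : ℕ) :
    word T a z (-l) l ++ word T a z 0 n ∈ language X := by
  have := hX.word_mem z (-l) (l + n)
  rwa [word_add, neg_add_cancel] at this

/-- A left extension of all finite prefixes extends the whole future. -/
theorem Codes.exists_fut [DiscreteTopology A] [Finite A] (hX : Codes T a X) {b : List A} {z : Z}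
    (h : ∀ n, b ++ word T a z 0 n ∈ language X) :
    ∃ y, Fut (orbit T (Setoid.ker a)) 0 z y ∧ word T a y (-b.length) b.length = b := by
  have hc : IsCompact X.carrier := X.isClosed.isCompact
  -- The points of `X` that show `b` before 0 and follow `z` for `n` steps form a decreasing
  -- sequence of non-empty compact sets; a common point is the extension sought.
  let F (n : ℕ) : Set (ℤ → A) := X.carrier ∩ {p | (∀ k : Fin b.length,
    p (-b.length + (k : ℕ)) = b.get k) ∧ ∀ i : ℕ, i < n → p i = a ((T ^ (i : ℤ)) z)}
  have hF : ∀ n, IsClosed (F n) := by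
    intro n
    refine X.isClosed.inter (IsClosed.inter ?_ ?_)
    · change IsClosed {p : ℤ → A | ∀ k : Fin b.length, p (-b.length + (k : ℕ)) = b.get k}
      rw [Set.ofPred_forall]
      exact isClosed_iInter fun k => isClosed_eq (continuous_apply _) continuous_const
    · change IsClosed {p : ℤ → A | ∀ i : ℕ, i < n → p i = a ((T ^ (i : ℤ)) z)}
      simp only [Set.ofPred_forall]
      exact isClosed_iInter fun k => isClosed_iInter fun _ =>
        isClosed_eq (continuous_apply _) continuous_const
  obtain ⟨p, hp⟩ := IsCompact.nonempty_iInter_of_sequence_nonempty_isCompact_isClosed F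
    (fun n p hp => ⟨hp.1, hp.2.1, fun i hi => hp.2.2 i (by omega)⟩)
    (fun n => by
      obtain ⟨y, hy1, hy2⟩ := hX.exists_word_append_eq (h n)
      rw [length_word] at hy2
      refine ⟨fun i => a ((T ^ i) y), (hX _).2 ⟨y, fun i => rfl⟩, fun k => ?_, fun i hi => ?_⟩
      · have := List.get_of_eq hy1 ⟨k.1, by simp⟩
        simpa [word] using this
      · exact word_eq_word_iff.1 hy2 i (by omega) (by omega))
    (hc.of_isClosed_subset (hF 0) Set.inter_subset_left) hF
  rw [Set.mem_iInter] at hp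
  obtain ⟨y, hy⟩ := (hX p).1 (hp 0).1
  refine ⟨y, fun i hi => ?_, ?_⟩
  · lift i to ℕ using hi
    have := (hp (i + 1)).2.2 i (by omega)
    rw [hy] at this
    exact this.symm
  · refine List.ext_get (by simp) fun k h1 h2 => ?_
    rw [← (hp 0).2.1 ⟨k, h2⟩, hy]
    simp [word]

/-- The prefix that decides the past is synchronizing: points realizing `b v` and `v c` have the
same past, so the first can precede the future of the second. -/
theorem Codes.exists_syncWords_of_reg (hX : Codes T a X) {l : ℕ} {z : Z}
    (hz : Reg (orbit T (Setoid.ker a)) (-l) 0 z) : ∃ n, word T a z 0 n ∈ syncWords X l := by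
  obtain ⟨N, hN⟩ := hz
  have hs : ∀ {y}, word T a y 0 N.toNat = word T a z 0 N.toNat →
      past (orbit T (Setoid.ker a)) (-l) 0 y = past (orbit T (Setoid.ker a)) (-l) 0 z := by
    intro y hy
    exact hN y ((word_eq_word_iff.1 hy.symm).mono le_rfl (by omega))
  refine ⟨N.toNat, mem_syncWords.2 ⟨hX.word_mem _ _ _, fun b c hb hbv hvc => ?_⟩⟩
  obtain ⟨x, hx1, hx2⟩ := hX.exists_word_append_eq hbv
  obtain ⟨y, hy⟩ := hX.exists_word_eq hvc 0
  rw [List.length_append, word_add] at hy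
  obtain ⟨hy1, hy2⟩ := List.append_inj hy (length_word _ _ _)
  rw [length_word] at hx2 hy1
  rw [length_word, zero_add] at hy2
  have hxy : x ∈ past (orbit T (Setoid.ker a)) (-l) 0 y := by
    rw [hs hy1, ← hs hx2]
    exact mem_past_self x
  obtain ⟨w, hw1, hw2⟩ := hxy
  have h := hX.append_word_mem w l (N.toNat + c.length)
  rw [word_eq_word_iff.2 (by simpa using hw2 : Seg _ (-l : ℤ) (-l + l) w x),
    ← word_eq_word_iff.2 hw1.seg, word_add, hy1, zero_add, hy2, ← hb, hx1, ← List.append_assoc] at h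
  exact h

variable [DiscreteTopology A] [Finite A]

/-- A synchronizing prefix already decides the past: a word that can precede `v` can precede every
longer prefix of the future, and by compactness the whole future. -/
theorem Codes.past_eq (hX : Codes T a X) {l : ℕ} {v : List A} {z : Z} (hv : v ∈ syncWords X l)
    (hz : word T a z 0 v.length = v) :
    past (orbit T (Setoid.ker a)) (-l) 0 z = {y | word T a y (-l) l ∈ predecessor X l v} := by
  ext y
  constructor
  · rintro ⟨w, hw1, hw2⟩
    rw [Set.mem_ofPred_eq, mem_predecessor]
    refine ⟨length_word _ _ _, ?_⟩
    rw [← word_eq_word_iff.2 (by simpa using hw2 : Seg _ (-l : ℤ) (-l + l) w y), ← hz,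
      word_eq_word_iff.2 hw1.seg]
    exact hX.append_word_mem w l _
  · intro hy
    rw [Set.mem_ofPred_eq, mem_predecessor] at hy
    have key : ∀ n, word T a y (-l) l ++ word T a z 0 n ∈ language X := by
      intro n
      have h1 := (mem_syncWords.1 hv).2 _ (word T a z v.length n) hy.1 hy.2 (by
        have := hX.word_mem z 0 (v.length + n)
        rwa [word_add, hz, zero_add] at this)
      -- The prefix of length `|v| + n` is cut in two ways; dropping its last `|v|` letters leaves
      -- the prefix of length `n`.
      have h2 : word T a z 0 v.length ++ word T a z v.length n =
          word T a z 0 n ++ word T a z n v.length := by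
        have h3 := word_add (T := T) (a := a) z 0 v.length n
        have h4 := word_add (T := T) (a := a) z 0 n v.length
        rw [zero_add] at h3 h4
        rw [← h3, ← h4, add_comm]
      rw [hz] at h2
      rw [List.append_assoc, h2, ← List.append_assoc] at h1
      exact language_left h1
    obtain ⟨w, hw1, hw2⟩ := hX.exists_fut key
    rw [length_word] at hw2
    have := word_eq_word_iff.1 hw2
    rw [neg_add_cancel] at this
    exact ⟨w, hw1, this⟩

theorem Codes.reg_of_syncWords (hX : Codes T a X) {l : ℕ} {v : List A} {z : Z}
    (hv : v ∈ syncWords X l) (hz : word T a z 0 v.length = v) :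
    Reg (orbit T (Setoid.ker a)) (-l) 0 z := by
  refine ⟨v.length, fun y hy => ?_⟩
  rw [hX.past_eq hv hz]
  refine hX.past_eq hv (Eq.trans (Eq.symm ?_) hz)
  exact word_eq_word_iff.2 (by simpa using hy)

theorem Codes.isSync (hX : Codes T a X) (h : IsLambdaSynchronizing X) :
    IsSync (orbit T (Setoid.ker a)) := by
  intro m n N x hn
  -- The past at `N` has length `N - m`; for `m > N` the truncation to 0 suffices, since the
  -- interval is then empty.
  obtain ⟨v, hv, -, hwv⟩ := h (word T a x n (N - n).toNat) (hX.word_mem _ _ _) (N - m).toNat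
  obtain ⟨y, hy⟩ := hX.exists_word_eq hwv n
  rw [List.length_append, word_add] at hy
  obtain ⟨hy1, hy2⟩ := List.append_inj hy (length_word _ _ _)
  rw [length_word] at hy1 hy2
  have hN : n + ((N - n).toNat : ℤ) = N := by omega
  rw [hN] at hy2
  refine ⟨y, (word_eq_word_iff.1 hy1.symm).mono le_rfl hN.ge, ?_⟩
  -- The word `v` starts at `N`, so regularity is obtained at the origin for `T ^ N` of the point
  -- and translated back.
  have h1 := hX.reg_of_syncWords hv (z := (T ^ N) y) (by rw [word_zpow, zero_add, hy2])
  have h2 := (reg_add_iff (e := orbit T (Setoid.ker a)) (T := T ^ N) (p := N) (fun i x y => by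
    change a _ = a _ ↔ a _ = a _
    rw [zpow_add]
    rfl)).2 h1
  rw [zero_add] at h2
  exact h2.mono (by omega)

theorem Codes.past_eq_iff (hX : Codes T a X) {l : ℕ} {v v' : List A} {z z' : Z}
    (hv : v ∈ syncWords X l) (hz : word T a z 0 v.length = v) (hv' : v' ∈ syncWords X l)
    (hz' : word T a z' 0 v'.length = v') :
    past (orbit T (Setoid.ker a)) (-l) 0 z = past (orbit T (Setoid.ker a)) (-l) 0 z' ↔
      predecessor X l v = predecessor X l v' := by
  rw [hX.past_eq hv hz, hX.past_eq hv' hz']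
  constructor
  · intro h
    have key : ∀ {v v'}, {y | word T a y (-l) l ∈ predecessor X l v} =
        {y | word T a y (-l) l ∈ predecessor X l v'} →
        predecessor X l v ⊆ predecessor X l v' := by
      intro v v' h b hb
      obtain ⟨y, hy, -⟩ := hX.exists_word_append_eq (mem_predecessor.1 hb).2
      rw [(mem_predecessor.1 hb).1] at hy
      have : y ∈ {y | word T a y (-l) l ∈ predecessor X l v} := by
        rw [Set.mem_ofPred_eq, hy]
        exact hb
      rw [h, Set.mem_ofPred_eq, hy] at this
      exact this
    exact (key h).antisymm (key h.symm)
  · intro h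
    rw [h]

/-- The matching of the pasts of regular points with the vertices of the `λ`-synchronizing
`λ`-graph system. -/
theorem Codes.exists_vertex_map (hX : Codes T a X) (l : ℕ) :
    ∃ f : PastVertex T (Setoid.ker a) l → Vertex X l, Function.Bijective f ∧
      ∀ S (v : syncWords X l) z, word T a z 0 v.1.length = v.1 →
        S.1 = past (orbit T (Setoid.ker a)) (-l) 0 z → f S = Vertex.mk X l v := by
  have h1 : ∀ S : PastVertex T (Setoid.ker a) l, ∃ (v : syncWords X l) (z : Z),
      word T a z 0 v.1.length = v.1 ∧ S.1 = past (orbit T (Setoid.ker a)) (-l) 0 z := by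
    rintro ⟨_, z, hz, rfl⟩
    obtain ⟨n, hn⟩ := hX.exists_syncWords_of_reg hz
    exact ⟨⟨_, hn⟩, z, by simp, rfl⟩
  choose v z hz hS using h1
  refine ⟨fun S => Vertex.mk X l (v S), ⟨?_, ?_⟩, ?_⟩
  · intro S S' h
    rw [Vertex.mk_eq_iff, ← hX.past_eq_iff (v S).2 (hz S) (v S').2 (hz S')] at h
    exact Subtype.ext ((hS S).trans (h.trans (hS S').symm))
  · intro w
    obtain ⟨μ, rfl⟩ := w.exists_mk
    obtain ⟨x, hx⟩ := hX.exists_word_eq μ.2.1 0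
    refine ⟨⟨_, (hX.reg_of_syncWords μ.2 hx).isVertex⟩, ?_⟩
    exact Vertex.mk_eq_iff.2 ((hX.past_eq_iff (v _).2 (hz _) μ.2 hx).1 (hS _).symm)
  · intro S μ x hx h
    rw [Vertex.mk_eq_iff, ← hX.past_eq_iff (v _).2 (hz _) μ.2 hx, ← h]
    exact (hS _).symm

theorem Codes.oneStep (hX : Codes T a X) (h : IsLambdaSynchronizing X)
    [Finite (Quotient (Setoid.ker a))] :
    StrongShiftEquivalentOneStep (lambdaGraphSystem X h).toSymbolicMatrixSystem
      (pastSystem T (Setoid.ker a) (hX.isSync h)) := by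
  choose f hf hfv using fun l => hX.exists_vertex_map l
  have hT := orbit_add_one T (Setoid.ker a)
  have hp : ∀ (l : ℕ) x, past (orbit T (Setoid.ker a)) (-l) 1 x =
      T ⁻¹' past (orbit T (Setoid.ker a)) (-(l + 1 : ℕ)) 0 (T x) := fun l x => by
    rw [← past_add hT]
    congr 1
    push_cast
    ring
  have hr : ∀ (l : ℕ) x, Reg (orbit T (Setoid.ker a)) (-l) 1 x ↔
      Reg (orbit T (Setoid.ker a)) (-(l + 1 : ℕ)) 0 (T x) := fun l x => by
    rw [← reg_add_iff hT, show -((l + 1 : ℕ) : ℤ) + 1 = -l by push_cast; ring, zero_add]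
  -- The map of alphabets is only injective, since a symbol of `A` need not occur in `X`.
  refine strongShiftEquivalentOneStep_of_bijective (lambdaGraphSystem_isPresentedBy h)
    (pastSystem_isPresentedBy T (Setoid.ker a) (hX.isSync h)) (fun l u α w => isEdge_iota_iff)
    f hf (Setoid.kerLift a) (Setoid.kerLift_injective a) ?_ ?_ ?_
  · rintro l ⟨_, z, hz, rfl⟩
    obtain ⟨n, hn⟩ := hX.exists_syncWords_of_reg hz
    refine Eq.trans ?_ (congrArg (Vertex.iota X l) (hfv (l + 1) _ ⟨_, hn⟩ z (by simp) rfl)).symm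
    exact hfv l _ ⟨_, syncWords_succ_subset l hn⟩ z (by simp) (sat_past (by push_cast; omega))
  · rintro l u _ w ⟨x, rfl, hx, hu, hw⟩
    rw [hp] at hw
    rw [hr] at hx
    obtain ⟨n, hn⟩ := hX.exists_syncWords_of_reg hx
    have hxn := word_succ (T := T) (a := a) x n
    have hμ : a x :: word T a (T x) 0 n ∈ syncWords X l :=
      cons_mem_syncWords hn (hxn ▸ hX.word_mem _ _ _)
    exact ⟨⟨_, hμ⟩, ⟨_, hn⟩, rfl, hfv l u _ x (by simpa using hxn) hu.symm,
      hfv (l + 1) w _ (T x) (by simp) (T.surjective.preimage_injective hw).symm⟩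
  · rintro l u (b : A) w ⟨⟨_, hμ⟩, ν, rfl, hu, hw⟩
    obtain ⟨x, hx⟩ := hX.exists_word_eq hμ.1 0
    have hx' := hx
    rw [List.length_cons, word_succ, List.cons.injEq] at hx'
    obtain ⟨rfl, hν⟩ := hx'
    have hxr := hX.reg_of_syncWords ν.2 hν
    refine ⟨Quotient.mk'' x, rfl, x, rfl, (hr l x).2 hxr, ?_, ?_⟩
    · rw [← hfv l ⟨_, (hX.reg_of_syncWords hμ hx).isVertex⟩ _ x hx rfl] at hu
      exact congrArg Subtype.val ((hf l).1 hu).symm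
    · rw [hp]
      rw [← hfv (l + 1) ⟨_, hxr.isVertex⟩ ν (T x) hν rfl] at hw
      exact congrArg (T ⁻¹' ·) (congrArg Subtype.val ((hf (l + 1)).1 hw).symm)

end Coding

/-! ### Topological conjugacies -/

section Conjugacy

variable {A : Type u} [TopologicalSpace A] (X : Subshift A ℤ)

/-- The shift as a permutation of the points of a subshift. -/
def shiftPerm : Equiv.Perm X.carrier where
  toFun x := ⟨shift 1 x.1, X.mapsTo 1 x.2⟩
  invFun x := ⟨shift (-1) x.1, X.mapsTo (-1) x.2⟩
  left_inv x := Subtype.ext (funext fun i => by simp)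
  right_inv x := Subtype.ext (funext fun i => by simp)

variable {X}

theorem shiftPerm_zpow_apply (k : ℤ) (x : X.carrier) (i : ℤ) :
    ((shiftPerm X ^ k) x).1 i = x.1 (i + k) := by
  have h1 : ∀ (y : X.carrier) (j : ℤ), (shiftPerm X y).1 j = y.1 (j + 1) := fun y j => by
    rw [add_comm]
    rfl
  have h2 : ∀ (y : X.carrier) (j : ℤ), ((shiftPerm X)⁻¹ y).1 j = y.1 (j - 1) := fun y j => by
    rw [sub_eq_add_neg, add_comm]
    rfl
  induction k generalizing i with
  | zero => simp
  | succ k ih =>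
    rw [add_comm (k : ℤ) 1, zpow_one_add, Equiv.Perm.mul_apply, h1, ih, add_assoc]
  | pred k ih =>
    rw [sub_eq_neg_add, zpow_add, zpow_neg_one, Equiv.Perm.mul_apply, h2, ih, sub_eq_add_neg,
      add_assoc]

/-- A continuous function from a subshift to a discrete space depends on a finite window. -/
theorem exists_window [DiscreteTopology A] [Finite A] {B : Type*} [TopologicalSpace B]
    [DiscreteTopology B] {g : X.carrier → B} (hg : Continuous g) :
    ∃ n : ℕ, ∀ x y : X.carrier, (∀ i : ℤ, -n ≤ i → i ≤ n → x.1 i = y.1 i) → g x = g y := by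
  by_contra! hcon
  have hc : CompactSpace X.carrier := isCompact_iff_compactSpace.1 X.isClosed.isCompact
  -- If no window works, compactness yields a pair on which `g` differs although all coordinates
  -- agree.
  let F (n : ℕ) : Set (X.carrier × X.carrier) :=
    {p | g p.1 ≠ g p.2} ∩ {p | ∀ i : ℤ, -n ≤ i → i ≤ n → p.1.1 i = p.2.1 i}
  have hF : ∀ n, IsClosed (F n) := by
    intro n
    refine IsClosed.inter ?_ ?_
    · exact (isClosed_discrete {q : B × B | q.1 ≠ q.2}).preimage (hg.prodMap hg)
    · simp only [Set.ofPred_forall]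
      exact isClosed_iInter fun i => isClosed_iInter fun _ => isClosed_iInter fun _ =>
        isClosed_eq ((continuous_apply i).comp (continuous_subtype_val.comp continuous_fst))
          ((continuous_apply i).comp (continuous_subtype_val.comp continuous_snd))
  obtain ⟨p, hp⟩ := IsCompact.nonempty_iInter_of_sequence_nonempty_isCompact_isClosed F
    (fun n p hp => ⟨hp.1, fun i h1 h2 => hp.2 i (by push_cast; omega) (by push_cast; omega)⟩)
    (fun n => by
      obtain ⟨x, y, h1, h2⟩ := hcon n
      exact ⟨(x, y), h2, h1⟩)
    (hF 0).isCompact hF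
  rw [Set.mem_iInter] at hp
  refine (hp 0).1 (congrArg g (Subtype.ext (funext fun i => ?_)))
  exact (hp i.natAbs).2 i (by omega) (by omega)

end Conjugacy
end LambdaSync

/-! ### The conjugacy as a change of partition -/

theorem proposition3p5 {A A' : Type u}
    [TopologicalSpace A] [DiscreteTopology A] [Finite A]
    [TopologicalSpace A'] [DiscreteTopology A'] [Finite A']
    (X : Subshift A ℤ) (X' : Subshift A' ℤ)
    (hX : LambdaSync.IsLambdaSynchronizing X) (hX' : LambdaSync.IsLambdaSynchronizing X')
    (hconj : LambdaSync.TopologicallyConjugate X X') :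
    LambdaSync.StrongShiftEquivalent
      (LambdaSync.lambdaGraphSystem X hX).toSymbolicMatrixSystem
      (LambdaSync.lambdaGraphSystem X' hX').toSymbolicMatrixSystem := by
  open LambdaSync in
  obtain ⟨h, hh⟩ := hconj
  let T := shiftPerm X
  let a : X.carrier → A := fun x => x.1 0
  let b : X.carrier → A' := fun x => (h x).1 0
  have hT : ∀ (i : ℤ) x, h ((T ^ i) x) = (shiftPerm X' ^ i) (h x) := by
    have h1 : h.toEquiv.permCongr T = shiftPerm X' := by
      ext1 y
      obtain ⟨x, rfl⟩ := h.surjective y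
      rw [Equiv.permCongr_apply]
      refine (congrArg (fun z => h (T z)) (h.symm_apply_apply x)).trans ?_
      exact Subtype.ext (hh x)
    intro i x
    have h2 := map_zpow h.toEquiv.permCongrHom T i
    have h3 : h.toEquiv.permCongrHom T = shiftPerm X' := h1
    rw [h3] at h2
    rw [← h2]
    exact (congrArg (fun z => h ((T ^ i) z)) (h.symm_apply_apply x)).symm
  have ha : ∀ (i : ℤ) x, a ((T ^ i) x) = x.1 i := fun i x => by
    change ((shiftPerm X ^ i) x).1 0 = _
    rw [shiftPerm_zpow_apply, zero_add]
  have hb : ∀ (i : ℤ) x, b ((T ^ i) x) = (h x).1 i := fun i x => by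
    change (h ((T ^ i) x)).1 0 = _
    rw [hT, shiftPerm_zpow_apply, zero_add]
  have hca : Codes T a X := fun p =>
    ⟨fun hp => ⟨⟨p, hp⟩, fun i => (ha i ⟨p, hp⟩).symm⟩, fun ⟨z, hz⟩ => by
      rw [show p = z.1 from funext fun i => (hz i).trans (ha i z)]
      exact z.2⟩
  have hcb : Codes T b X' := fun p =>
    ⟨fun hp => ⟨h.symm ⟨p, hp⟩, fun i => by rw [hb, h.apply_symm_apply]⟩, fun ⟨z, hz⟩ => by
      rw [show p = (h z).1 from funext fun i => (hz i).trans (hb i z)]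
      exact (h z).2⟩
  have hfa : Finite (Quotient (Setoid.ker a)) := .of_injective _ (Setoid.kerLift_injective a)
  have hfb : Finite (Quotient (Setoid.ker b)) := .of_injective _ (Setoid.kerLift_injective b)
  -- The windows of the conjugacy and of its inverse are the numbers of widenings by which each
  -- partition refines the other.
  obtain ⟨n, hn⟩ := exists_window (g := b)
    ((continuous_apply 0).comp (continuous_subtype_val.comp h.continuous))
  obtain ⟨k, hk⟩ := exists_window (g := fun y => a (h.symm y))
    ((continuous_apply 0).comp (continuous_subtype_val.comp h.symm.continuous))
  have hl : Linked T (Setoid.ker a) (Setoid.ker b) := by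
    refine linked_of_iterate_widen_le (n := n) (k := k) (fun x y hxy => ?_) fun x y hxy => ?_
    · refine hn x y fun i h1 h2 => ?_
      rw [← ha, ← ha]
      exact iterate_widen_apply hxy i h1 h2
    · have := hk (h x) (h y) fun i h1 h2 => by
        rw [← hb, ← hb]
        exact iterate_widen_apply hxy i h1 h2
      rwa [h.symm_apply_apply, h.symm_apply_apply] at this
  exact (Relation.TransGen.single (hca.oneStep hX)).trans
    ((hl.strongShiftEquivalent (hca.isSync hX) (hcb.isSync hX')).trans
      (.single (hcb.oneStep hX').symm))
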